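/- Let $d\ge 1$ and let $(M,K,\eta)$ be an almost para-Kähler manifold of dimension $2d$. That is, $M$ is a smooth, Hausdorff, second countable manifold of dimension $2d$; $\eta$ is a smooth pseudo-Riemannian metric of split signature $(d,d)$; $K$ is a smooth bundle endomorphism of $TM$ with $K^2=1$, $K\neq\pm1$, whose $\pm1$-eigenbundles have rank $d$; $\eta(KX,KY)=-\eta(X,Y)$; and the fundamental $2$-form $\omega(X,Y)=\eta(KX,Y)$ is closed. Let $\mathbb{T}M=TM\oplus T^*M$ be the large (untwisted standard) Courant algebroid over $M$, with anchor $\rho(X+\alpha)=X$, pairing $\langle X+\alpha,Y+\beta\rangle_{\mathbb{T}M}=\beta(X)+\alpha(Y)$ and Dorfman bracket $[X+\alpha,Y+\beta]_{\tt D}=[X,Y]+\pounds_X\beta-\iota_Y\mathrm{d}\alpha$. Let $C_+=\{X+\eta(X,\cdot)\}\subset\mathbb{T}M$ be the $+1$-eigenbundle of the involution $\mathcal{I}_0(X+\alpha)=\eta^{-1}(\alpha)+\eta(X,\cdot)$ (the case $b=0$), let $\mathtt{p}_+=\frac12(1+\mathcal I_0)$ be the projection to $C_+$, and put $$[\![\xi,\xi']\!]_{\tt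 D}^+=\mathtt{p}_+\big([\xi,\xi']_{\tt D}\big),\qquad \langle\xi,\xi'\rangle_{C_+}=\tfrac12\langle\xi,\xi'\rangle_{\mathbb{T}M},\qquad \rho_+=\rho|_{C_+}$$ for sections $\xi,\xi'$ of $C_+$. Let $K^{\rm t}:T^*M\to T^*M$, $\alpha\mapsto\alpha\circ K$, be the transpose of $K$, so that $K-K^{\rm t}$ acts on $\mathbb{T}M$ by $X+\alpha\mapsto KX-\alpha\circ K$. A metric algebroid over $M$ is a smooth vector bundle $A\to M$ with a smooth bundle map $\rho_A:A\to TM$, a smooth fibrewise symmetric non-degenerate pairing $\langle\cdot,\cdot\rangle_A$, and an $\mathbb{R}$-bilinear bracket on smooth sections such that, for all sections $e,e_1,e_2$ and smooth functions $f$: $[\![e,fe_1]\!]=f[\![e,e_1]\!]+(\rho_A(e)\cdot f)e_1$, $\;\rho_A(e)\cdot\langle e_1,e_2\rangle_A=\langle[\![e,e_1]\!],e_2\rangle_A+\langle e_1,[\![e,e_2]\!]\rangle_A$, and $\langle[\![e,e]\!],e_1\rangle_A=\frac12\rho_A(e_1)\cdot\langle e,e\rangle_A$. An isomorphism of metric algebroids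 over $M$ is a smooth vector bundle isomorphism covering the identity of $M$ that intertwines the anchors and the brackets and is an isometry. Then $\rho_+:C_+\to TM$ is a bundle isomorphism, $K-K^{\rm t}$ preserves $C_+$, the endomorphism $K'=\rho_+\circ(K-K^{\rm t})\circ\rho_+^{-1}$ of $TM$ is a para-complex structure for which $(K',\eta)$ is an almost para-Hermitian structure on $M$ (all the conditions above except closedness of the fundamental form), $(C_+,[\![\cdot,\cdot]\!]_{\tt D}^+,\langle\cdot,\cdot\rangle_{C_+},\rho_+)$ is a metric algebroid, and $\rho_+$ is an isomorphism of metric algebroids from it to the canonical metric algebroid $(TM,[\![\cdot,\cdot]\!]_{\tt D}^{K'},\eta,1)$ of $(M,K',\eta)$. Here, with $\nabla^{\tt LC}$ the Levi-Civita connection of $\eta$, $P_\pm=\frac12(1\pm K')$ and $\nabla=P_+\circ\nabla^{\tt LC}\circ P_++P_-\circ\nabla^{\tt LC}\circ P_-$, the bracket is defined by $$\eta\big([\![X,Y]\!]_{\tt D}^{K'},Z\big)=\eta(\nabla_XY-\nabla_YX,Z)+\eta(\nabla_ZX,Y)$$ for all vector fields $X,Y,Z$; in particular $(TM,[\![\cdot,\cdot]\!]_{\tt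 D}^{K'},\eta,1)$ is a metric algebroid. -/

import Mathlib

open Bundle Set Module VectorField FiberBundle
open scoped Manifold ContDiff Topology

noncomputable section

namespace DoubledGeometry

variable {E : Type*} [NormedAddCommGroup E] [NormedSpace ℝ E] [FiniteDimensional ℝ E]
  {H : Type*} [TopologicalSpace H] (I : ModelWithCorners ℝ E H)
  {M : Type*} [TopologicalSpace M] [ChartedSpace H M]

instance tangentSpace_finiteDimensional (x : M) : FiniteDimensional ℝ (TangentSpace I x) :=
  inferInstanceAs (FiniteDimensional ℝ E)

instance tangentSpace_t2Space (x : M) : T2Space (TangentSpace I x) := inferInstanceAs (T2Space E)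

/-- The cotangent space `T*ₓM`; the corresponding bundle is Mathlib's bundle of continuous linear
maps from the tangent bundle to the trivial line bundle. -/
abbrev Cotangent (x : M) : Type _ := TangentSpace I x →L[ℝ] ℝ

/-- The fibre `TₓM ⊕ T*ₓM` of the generalized tangent bundle `𝕋M`, with Mathlib's bundle structure
on a direct sum of bundles. -/
abbrev GenTangent (x : M) : Type _ := TangentSpace I x × Cotangent I x

variable {I}

variable [IsManifold I ∞ M]

/-! ### Smooth sections -/

section Sections

variable (I)
variable (F : Type*) [NormedAddCommGroup F] [NormedSpace ℝ F]
  {V : M → Type*} [TopologicalSpace (TotalSpace F V)] [∀ x, TopologicalSpace (V x)]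
  [FiberBundle F V]

/-- The section `s` of the bundle `V` (with model fibre `F`) is smooth at `x`. -/
def SmoothAt (s : ∀ x : M, V x) (x : M) : Prop :=
  ContMDiffAt I (I.prod 𝓘(ℝ, F)) ∞ (fun y ↦ TotalSpace.mk' F y (s y)) x

/-- The section `s` of the bundle `V` is smooth. -/
def Smooth (s : ∀ x : M, V x) : Prop := ∀ x, SmoothAt I F s x

end Sections

/-! ### Metric algebroids

A vector bundle is presented as a smooth subbundle of a Mathlib vector bundle `V` (possibly all of
`V`): a family `W` of subspaces of the fibres, locally spanned by a smooth frame. -/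

section Algebroids

variable (I)
variable (F : Type*) [NormedAddCommGroup F] [NormedSpace ℝ F]
  {V : M → Type*} [TopologicalSpace (TotalSpace F V)] [∀ x, AddCommGroup (V x)]
  [∀ x, Module ℝ (V x)] [∀ x, TopologicalSpace (V x)] [FiberBundle F V]

/-- The family of subspaces `W x ⊆ V x` is a smooth vector subbundle of `V`: every point has an open
neighbourhood on which `W` has a smooth frame. -/
def IsSmoothSubbundle (W : ∀ x : M, Submodule ℝ (V x)) : Prop :=
  ∀ x₀ : M, ∃ U : Set M, IsOpen U ∧ x₀ ∈ U ∧ ∃ (n : ℕ) (b : Fin n → ∀ x : M, V x),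
    ∀ x ∈ U, (∀ i, SmoothAt I F (b i) x) ∧ LinearIndependent ℝ (fun i ↦ b i x) ∧
      Submodule.span ℝ (Set.range fun i ↦ b i x) = W x

/-- The smooth sections of the subbundle `W` of `V`. -/
def sectionsOf (W : ∀ x : M, Submodule ℝ (V x)) : Set (∀ x : M, V x) :=
  {s | (∀ x, s x ∈ W x) ∧ Smooth I F s}

variable (V) in
/-- The data of a metric algebroid on a subbundle of `V`. The bracket is only meaningful on smooth
sections of the subbundle, the pairing and the anchor only on vectors of the subbundle; their values
elsewhere are irrelevant to all notions below. -/
structure AlgebroidData where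
  /-- the fibres of the underlying vector bundle -/
  fibre (x : M) : Submodule ℝ (V x)
  /-- the bracket on sections -/
  bracket (s t : ∀ x : M, V x) (x : M) : V x
  /-- the fibrewise pairing -/
  pairing (x : M) : V x →ₗ[ℝ] V x →ₗ[ℝ] ℝ
  /-- the anchor map to the tangent bundle -/
  anchor (x : M) : V x →ₗ[ℝ] TangentSpace I x

variable {I}

/-- The smooth sections of the vector bundle underlying an algebroid. -/
def AlgebroidData.sections (A : AlgebroidData I V) : Set (∀ x : M, V x) := sectionsOf I F A.fibre

/-- The function `ρ(e) · f`, the derivative of `f` along the vector field `ρ(e)`. -/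
def AlgebroidData.deriv (A : AlgebroidData I V) (e : ∀ x : M, V x) (f : M → ℝ) (x : M) : ℝ :=
  d% f x (A.anchor x (e x))

/-- The data `A` form a metric algebroid. -/
structure IsMetricAlgebroid (A : AlgebroidData I V) : Prop where
  /-- the underlying bundle is a smooth vector bundle -/
  subbundle : IsSmoothSubbundle I F A.fibre
  /-- the anchor is a smooth bundle map -/
  anchor_smooth : ∀ e : ∀ x : M, V x, (∀ x, e x ∈ A.fibre x) → ∀ x, SmoothAt I F e x →
    SmoothAt I E (fun y ↦ A.anchor y (e y)) x
  /-- the pairing is smooth -/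
  pairing_smooth : ∀ e₁ e₂ : ∀ x : M, V x, (∀ x, e₁ x ∈ A.fibre x) → (∀ x, e₂ x ∈ A.fibre x) →
    ∀ x, SmoothAt I F e₁ x → SmoothAt I F e₂ x →
      ContMDiffAt I 𝓘(ℝ, ℝ) ∞ (fun y ↦ A.pairing y (e₁ y) (e₂ y)) x
  pairing_symm : ∀ x, ∀ v ∈ A.fibre x, ∀ w ∈ A.fibre x, A.pairing x v w = A.pairing x w v
  pairing_nondegenerate : ∀ x, ∀ v ∈ A.fibre x, (∀ w ∈ A.fibre x, A.pairing x v w = 0) → v = 0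
  /-- the bracket of two smooth sections is a smooth section -/
  bracket_mem : ∀ e₁ ∈ A.sections F, ∀ e₂ ∈ A.sections F, A.bracket e₁ e₂ ∈ A.sections F
  bracket_add_left : ∀ e₁ ∈ A.sections F, ∀ e₂ ∈ A.sections F, ∀ e ∈ A.sections F,
    A.bracket (e₁ + e₂) e = A.bracket e₁ e + A.bracket e₂ e
  bracket_add_right : ∀ e ∈ A.sections F, ∀ e₁ ∈ A.sections F, ∀ e₂ ∈ A.sections F,
    A.bracket e (e₁ + e₂) = A.bracket e e₁ + A.bracket e e₂
  bracket_smul_left : ∀ (c : ℝ), ∀ e₁ ∈ A.sections F, ∀ e₂ ∈ A.sections F,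
    A.bracket (c • e₁) e₂ = c • A.bracket e₁ e₂
  bracket_smul_right : ∀ (c : ℝ), ∀ e₁ ∈ A.sections F, ∀ e₂ ∈ A.sections F,
    A.bracket e₁ (c • e₂) = c • A.bracket e₁ e₂
  /-- anchored derivation property `[e, f e'] = f [e, e'] + (ρ(e) · f) e'` -/
  anchored_derivation : ∀ e ∈ A.sections F, ∀ e' ∈ A.sections F, ∀ f : M → ℝ,
    ContMDiff I 𝓘(ℝ, ℝ) ∞ f → ∀ x,
      A.bracket e (fun y ↦ f y • e' y) x = f x • A.bracket e e' x + A.deriv e f x • e' x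
  /-- `ρ(e) · ⟨e₁, e₂⟩ = ⟨[e, e₁], e₂⟩ + ⟨e₁, [e, e₂]⟩` -/
  bracket_metric : ∀ e ∈ A.sections F, ∀ e₁ ∈ A.sections F, ∀ e₂ ∈ A.sections F, ∀ x,
    A.deriv e (fun y ↦ A.pairing y (e₁ y) (e₂ y)) x =
      A.pairing x (A.bracket e e₁ x) (e₂ x) + A.pairing x (e₁ x) (A.bracket e e₂ x)
  /-- `⟨[e, e], e₁⟩ = ½ ρ(e₁) · ⟨e, e⟩` -/
  bracket_self : ∀ e ∈ A.sections F, ∀ e₁ ∈ A.sections F, ∀ x,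
    A.pairing x (A.bracket e e x) (e₁ x) =
      (1 / 2) * A.deriv e₁ (fun y ↦ A.pairing y (e y) (e y)) x

variable (F' : Type*) [NormedAddCommGroup F'] [NormedSpace ℝ F']
  {V' : M → Type*} [TopologicalSpace (TotalSpace F' V')] [∀ x, AddCommGroup (V' x)]
  [∀ x, Module ℝ (V' x)] [∀ x, TopologicalSpace (V' x)] [FiberBundle F' V']

/-- The fibrewise linear map `ψ`, restricted to the bundle underlying `A`, is an isomorphism of
metric algebroids from `A` to `A'` (covering the identity of `M`). -/
structure IsMetricAlgebroidIso (A : AlgebroidData I V) (A' : AlgebroidData I V')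
    (ψ : ∀ x : M, V x →ₗ[ℝ] V' x) : Prop where
  /-- `ψ` is bijective from the fibres of `A` to those of `A'` -/
  bijOn : ∀ x, Set.BijOn (ψ x) (A.fibre x) (A'.fibre x)
  /-- `ψ` and its inverse are smooth bundle maps -/
  smooth_iff : ∀ e : ∀ x : M, V x, (∀ x, e x ∈ A.fibre x) → ∀ x,
    SmoothAt I F' (fun y ↦ ψ y (e y)) x ↔ SmoothAt I F e x
  /-- `ψ` intertwines the anchor maps -/
  anchor_comp : ∀ x, ∀ v ∈ A.fibre x, A'.anchor x (ψ x v) = A.anchor x v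
  /-- `ψ` is an isometry -/
  isometry : ∀ x, ∀ v ∈ A.fibre x, ∀ w ∈ A.fibre x,
    A'.pairing x (ψ x v) (ψ x w) = A.pairing x v w
  /-- `ψ` intertwines the brackets -/
  map_bracket : ∀ e₁ ∈ A.sections F, ∀ e₂ ∈ A.sections F, ∀ x,
    ψ x (A.bracket e₁ e₂ x) = A'.bracket (fun y ↦ ψ y (e₁ y)) (fun y ↦ ψ y (e₂ y)) x

end Algebroids

/-! ### Calculus of one-forms

As usual in Mathlib, operations are defined on arbitrary sections, with junk value `0` when the
sections involved are not differentiable. -/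

/-- The one-form `α` is differentiable at `x`. -/
def FormDiffAt (α : ∀ x : M, Cotangent I x) (x : M) : Prop :=
  MDifferentiableAt I (I.prod 𝓘(ℝ, E →L[ℝ] ℝ))
    (fun y ↦ (TotalSpace.mk' (E →L[ℝ] ℝ) y (α y) : TotalSpace (E →L[ℝ] ℝ) (Cotangent I))) x

lemma FormDiffAt.apply {α : ∀ x : M, Cotangent I x} {x : M} (hα : FormDiffAt α x)
    {Y : ∀ x : M, TangentSpace I x} (hY : MDiffAt (T% Y) x) :
    MDiffAt (fun y ↦ α y (Y y)) x := by
  have := MDifferentiableAt.clm_bundle_apply (F₁ := E) (F₂ := ℝ)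
    (E₁ := (TangentSpace I : M → Type _)) (E₂ := Bundle.Trivial M ℝ) (b := fun y ↦ y)
    (ϕ := α) (v := Y) hα hY
  simp only [mdifferentiableAt_totalSpace] at this
  simpa using this.2

/-- `Y(α(Z)) - Z(α(Y)) - α([Y, Z])` at `x`. -/
def dOneFormAux (α : ∀ x : M, Cotangent I x) (x : M) (Y Z : ∀ x : M, TangentSpace I x) : ℝ :=
  d% (fun y ↦ α y (Z y)) x (Y x) - d% (fun y ↦ α y (Y y)) x (Z x) - α x (mlieBracket I Y Z x)

lemma dOneFormAux_swap (α : ∀ x : M, Cotangent I x) (x : M) (Y Z : ∀ x : M, TangentSpace I x) :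
    dOneFormAux α x Y Z = - dOneFormAux α x Z Y := by
  simp only [dOneFormAux, mlieBracket_swap_apply (V := Z) (W := Y), map_neg]
  ring

lemma tensorial_dOneFormAux {α : ∀ x : M, Cotangent I x} {x : M} (hα : FormDiffAt α x)
    (Z : ∀ x : M, TangentSpace I x) : TensorialAt I E (dOneFormAux α x · Z) x where
  smul {f Y} hf hY := by
    have h1 := mvfderiv_fun_mul hf (hα.apply hY)
    simp [dOneFormAux, mlieBracket_smul_left hf hY, h1]
    ring
  add {Y Y'} hY hY' := by
    have h1 := mvfderiv_fun_add (hα.apply hY) (hα.apply hY')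
    simp [dOneFormAux, mlieBracket_add_left hY hY', h1]
    ring

lemma tensorial_dOneFormAux' {α : ∀ x : M, Cotangent I x} {x : M} (hα : FormDiffAt α x)
    (Y : ∀ x : M, TangentSpace I x) : TensorialAt I E (dOneFormAux α x Y) x where
  smul {f Z} hf hZ := by
    rw [dOneFormAux_swap, dOneFormAux_swap (Y := Y), (tensorial_dOneFormAux hα Y).smul hf hZ,
      smul_neg]
  add {Z Z'} hZ hZ' := by
    rw [dOneFormAux_swap, dOneFormAux_swap (Y := Y), dOneFormAux_swap (Y := Y) (Z := Z'),
      (tensorial_dOneFormAux hα Y).add hZ hZ']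
    ring

open Classical in
/-- The exterior derivative of a one-form: the tensor `dα` with
`dα(Y, Z) = Y(α(Z)) - Z(α(Y)) - α([Y, Z])` for all vector fields `Y`, `Z`. -/
def dOneForm (α : ∀ x : M, Cotangent I x) (x : M) :
    TangentSpace I x →L[ℝ] TangentSpace I x →L[ℝ] ℝ :=
  if hα : FormDiffAt α x then
    TensorialAt.mkHom₂ (dOneFormAux α x) x
      (fun Z _ ↦ tensorial_dOneFormAux hα Z) (fun Y _ ↦ tensorial_dOneFormAux' hα Y)
  else 0

/-- `X(β(Z)) - β([X, Z])` at `x`. -/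
def lieOneFormAux (X : ∀ x : M, TangentSpace I x) (β : ∀ x : M, Cotangent I x) (x : M)
    (Z : ∀ x : M, TangentSpace I x) : ℝ :=
  d% (fun y ↦ β y (Z y)) x (X x) - β x (mlieBracket I X Z x)

lemma tensorial_lieOneFormAux (X : ∀ x : M, TangentSpace I x) {β : ∀ x : M, Cotangent I x} {x : M}
    (hβ : FormDiffAt β x) : TensorialAt I E (lieOneFormAux X β x) x where
  smul {f Z} hf hZ := by
    have h1 := mvfderiv_fun_mul hf (hβ.apply hZ)
    simp [lieOneFormAux, mlieBracket_smul_right hf hZ, h1]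
    ring
  add {Z Z'} hZ hZ' := by
    have h1 := mvfderiv_fun_add (hβ.apply hZ) (hβ.apply hZ')
    simp [lieOneFormAux, mlieBracket_add_right hZ hZ', h1]
    ring

open Classical in
/-- The Lie derivative `£_X β` of a one-form: `(£_X β)(Z) = X(β(Z)) - β([X, Z])` for all vector
fields `Z`. -/
def lieOneForm (X : ∀ x : M, TangentSpace I x) (β : ∀ x : M, Cotangent I x) (x : M) :
    Cotangent I x :=
  if hβ : FormDiffAt β x then
    TensorialAt.mkHom (lieOneFormAux X β x) x (tensorial_lieOneFormAux X hβ)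
  else 0

/-! ### The standard Courant algebroid on `𝕋M = TM ⊕ T*M` -/

/-- The Dorfman bracket `[X + α, Y + β] = [X, Y] + £_X β - ι_Y dα`. -/
def dorfman (s t : ∀ x : M, GenTangent I x) (x : M) : GenTangent I x :=
  (mlieBracket I (fun y ↦ (s y).1) (fun y ↦ (t y).1) x,
    lieOneForm (fun y ↦ (s y).1) (fun y ↦ (t y).2) x - dOneForm (fun y ↦ (s y).2) x (t x).1)

variable (I) in
/-- The pairing `⟨X + α, Y + β⟩ = β(X) + α(Y)`. -/
def genPairing (x : M) : GenTangent I x →ₗ[ℝ] GenTangent I x →ₗ[ℝ] ℝ :=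
  LinearMap.mk₂ ℝ (fun p q ↦ q.2 p.1 + p.2 q.1)
    (fun p p' q ↦ by simp; ring) (fun c p q ↦ by simp; ring)
    (fun p q q' ↦ by simp; ring) (fun c p q ↦ by simp; ring)

variable (I) in
/-- The anchor `ρ(X + α) = X`. -/
def genAnchor (x : M) : GenTangent I x →ₗ[ℝ] TangentSpace I x := LinearMap.fst ℝ _ _

/-- The large Courant algebroid on `M`: the standard Courant algebroid on `𝕋M`. -/
def largeCourant : AlgebroidData I (GenTangent I : M → Type _) where
  fibre _ := ⊤
  bracket := dorfman
  pairing := genPairing I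
  anchor := genAnchor I

/-! ### Pseudo-Riemannian metrics -/

variable (I M) in
/-- A smooth pseudo-Riemannian metric on `M`. -/
structure PseudoRiemannianMetric where
  /-- the bilinear form on each tangent space -/
  toFun (x : M) : TangentSpace I x →L[ℝ] TangentSpace I x →L[ℝ] ℝ
  symm (x : M) (v w : TangentSpace I x) : toFun x v w = toFun x w v
  nondegenerate (x : M) (v : TangentSpace I x) (hv : ∀ w, toFun x v w = 0) : v = 0
  contMDiff : ContMDiff I (I.prod 𝓘(ℝ, E →L[ℝ] E →L[ℝ] ℝ)) ∞
    (fun x ↦ TotalSpace.mk' (E →L[ℝ] E →L[ℝ] ℝ) x (toFun x))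

namespace PseudoRiemannianMetric

instance : CoeFun (PseudoRiemannianMetric I M)
    (fun _ ↦ ∀ x : M, TangentSpace I x →L[ℝ] TangentSpace I x →L[ℝ] ℝ) := ⟨toFun⟩

variable (η : PseudoRiemannianMetric I M)

/-- The musical isomorphism `η♭ : TₓM → T*ₓM`, `v ↦ η(v, ·)`; its inverse is `η⁻¹♯`. -/
def flat (x : M) : TangentSpace I x ≃ₗ[ℝ] Cotangent I x :=
  LinearEquiv.ofInjectiveOfFinrankEq (η x).toLinearMap
    (by
      rw [← LinearMap.ker_eq_bot, LinearMap.ker_eq_bot']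
      intro v hv
      exact η.nondegenerate x v fun w ↦ by
        have := congrArg (fun φ : Cotangent I x ↦ φ w) hv
        simpa using this)
    (by
      rw [← (LinearMap.toContinuousLinearMap (𝕜 := ℝ) (E := TangentSpace I x)
        (F' := ℝ)).finrank_eq]
      exact (Subspace.dual_finrank_eq).symm)

lemma flat_apply (x : M) (v : TangentSpace I x) : η.flat x v = η x v := rfl

lemma apply_flat_symm (x : M) (φ : Cotangent I x) (w : TangentSpace I x) :
    η x ((η.flat x).symm φ) w = φ w := by
  rw [← η.flat_apply, LinearEquiv.apply_symm_apply]

lemma eq_of_apply {x : M} {v v' : TangentSpace I x} (h : ∀ w, η x v w = η x v' w) : v = v' :=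
  (η.flat x).injective (ContinuousLinearMap.ext h)

lemma diffAt {Y Z : ∀ x : M, TangentSpace I x} {x : M} (hY : MDiffAt (T% Y) x)
    (hZ : MDiffAt (T% Z) x) : MDiffAt (fun y ↦ η y (Y y) (Z y)) x := by
  have hη := (η.contMDiff x).mdifferentiableAt (by simp)
  have h1 := MDifferentiableAt.clm_bundle_apply (F₁ := E) (F₂ := E →L[ℝ] ℝ)
    (E₁ := (TangentSpace I : M → Type _))
    (E₂ := (Cotangent I : M → Type _)) (b := fun y ↦ y) (ϕ := η.toFun) (v := Y) hη hY
  exact FormDiffAt.apply h1 hZ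

/-- `η` as a bilinear form on `TₓM`. -/
def bilin (x : M) : LinearMap.BilinForm ℝ (TangentSpace I x) :=
  LinearMap.mk₂ ℝ (fun v w ↦ η x v w)
    (fun v v' w ↦ by simp) (fun c v w ↦ by simp) (fun v w w' ↦ by simp) (fun c v w ↦ by simp)

end PseudoRiemannianMetric

variable (η : PseudoRiemannianMetric I M)

/-! ### The Levi-Civita connection -/

/-- `D` is a Levi-Civita connection of `η`: it is torsion-free and compatible with `η`. -/
structure IsLeviCivita (D : CovariantDerivative I E (TangentSpace I : M → Type _)) : Prop where
  torsion_eq_zero : D.torsion = 0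
  metric : ∀ (x : M) (Y Z : ∀ x : M, TangentSpace I x), MDiffAt (T% Y) x → MDiffAt (T% Z) x →
    ∀ v : TangentSpace I x, d% (fun y ↦ η y (Y y) (Z y)) x v
      = η x (D Y x v) (Z x) + η x (Y x) (D Z x v)

/-- Koszul's expression for `η(∇_X Y, Z)` at `x`. -/
def koszul (Y : ∀ x : M, TangentSpace I x) (x : M) (X Z : ∀ x : M, TangentSpace I x) : ℝ :=
  (d% (fun y ↦ η y (Y y) (Z y)) x (X x) + d% (fun y ↦ η y (X y) (Z y)) x (Y x)
    - d% (fun y ↦ η y (X y) (Y y)) x (Z x) + η x (mlieBracket I X Y x) (Z x)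
    - η x (mlieBracket I X Z x) (Y x) - η x (mlieBracket I Y Z x) (X x)) / 2

lemma tensorial_koszul_left {Y Z : ∀ x : M, TangentSpace I x} {x : M} (hY : MDiffAt (T% Y) x)
    (hZ : MDiffAt (T% Z) x) : TensorialAt I E (koszul η Y x · Z) x where
  smul {f X} hf hX := by
    have h1 := mvfderiv_fun_mul hf (η.diffAt hX hZ)
    have h2 := mvfderiv_fun_mul hf (η.diffAt hX hY)
    simp [koszul, mlieBracket_smul_left hf hX, h1, h2]
    ring
  add {X X'} hX hX' := by
    have h1 := mvfderiv_fun_add (η.diffAt hX hZ) (η.diffAt hX' hZ)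
    have h2 := mvfderiv_fun_add (η.diffAt hX hY) (η.diffAt hX' hY)
    simp [koszul, mlieBracket_add_left hX hX', h1, h2]
    ring

lemma tensorial_koszul_right {Y X : ∀ x : M, TangentSpace I x} {x : M} (hY : MDiffAt (T% Y) x)
    (hX : MDiffAt (T% X) x) : TensorialAt I E (koszul η Y x X) x where
  smul {f Z} hf hZ := by
    have h1 := mvfderiv_fun_mul hf (η.diffAt hX hZ)
    have h2 := mvfderiv_fun_mul hf (η.diffAt hY hZ)
    simp [koszul, mlieBracket_smul_right hf hZ, h1, h2]
    rw [η.symm x (Z x) (X x), η.symm x (Z x) (Y x)]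
    ring
  add {Z Z'} hZ hZ' := by
    have h1 := mvfderiv_fun_add (η.diffAt hX hZ) (η.diffAt hX hZ')
    have h2 := mvfderiv_fun_add (η.diffAt hY hZ) (η.diffAt hY hZ')
    simp [koszul, mlieBracket_add_right hZ hZ', h1, h2]
    ring

open Classical in
/-- `∇Y` at `x`, given by Koszul's formula. -/
def leviCivitaFun (Y : ∀ x : M, TangentSpace I x) (x : M) :
    TangentSpace I x →L[ℝ] TangentSpace I x :=
  if hY : MDiffAt (T% Y) x then
    (LinearMap.toContinuousLinearMap (η.flat x).symm.toLinearMap) ∘L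
      TensorialAt.mkHom₂ (koszul η Y x) x
        (fun _ hZ ↦ tensorial_koszul_left η hY hZ) (fun _ hX ↦ tensorial_koszul_right η hY hX)
  else 0

lemma leviCivitaFun_apply {Y X Z : ∀ x : M, TangentSpace I x} {x : M} (hY : MDiffAt (T% Y) x)
    (hX : MDiffAt (T% X) x) (hZ : MDiffAt (T% Z) x) :
    η x (leviCivitaFun η Y x (X x)) (Z x) = koszul η Y x X Z := by
  rw [leviCivitaFun, dif_pos hY]
  simp only [ContinuousLinearMap.comp_apply, LinearMap.coe_toContinuousLinearMap',
    LinearEquiv.coe_coe, η.apply_flat_symm]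
  exact TensorialAt.mkHom₂_apply _ _ hX hZ

/-- Linear maps into a tangent space agree if they agree after pairing with all local vector fields
that are differentiable at the point. -/
lemma clm_ext_of_fields {x : M} {A B : TangentSpace I x →L[ℝ] TangentSpace I x}
    (h : ∀ X Z : ∀ x : M, TangentSpace I x, MDiffAt (T% X) x → MDiffAt (T% Z) x →
      η x (A (X x)) (Z x) = η x (B (X x)) (Z x)) : A = B := by
  ext v
  refine η.eq_of_apply fun w ↦ ?_
  have := h (FiberBundle.extend E v) (FiberBundle.extend E w)
    (mdifferentiableAt_extend ..) (mdifferentiableAt_extend ..)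
  simpa using this

/-- The Levi-Civita connection of a pseudo-Riemannian metric. -/
def leviCivita : CovariantDerivative I E (TangentSpace I : M → Type _) where
  toFun := leviCivitaFun η
  isCovariantDerivativeOnUniv :=
    { add := by
        intro Y Y' x hY hY' _
        refine clm_ext_of_fields η fun X Z hX hZ ↦ ?_
        have hYY : MDiffAt (T% (Y + Y')) x := mdifferentiableAt_add_section hY hY'
        have h1 := mvfderiv_fun_add (η.diffAt hY hZ) (η.diffAt hY' hZ)
        have h2 := mvfderiv_fun_add (η.diffAt hX hY) (η.diffAt hX hY')
        rw [leviCivitaFun_apply η hYY hX hZ, add_apply, map_add,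
          add_apply, leviCivitaFun_apply η hY hX hZ,
          leviCivitaFun_apply η hY' hX hZ]
        simp [koszul, mlieBracket_add_left hY hY', mlieBracket_add_right hY hY', h1, h2]
        ring
      leibniz := by
        intro Y f x hY hf _
        refine clm_ext_of_fields η fun X Z hX hZ ↦ ?_
        have hfY : MDiffAt (T% (f • Y)) x := hf.smul_section hY
        have h1 := mvfderiv_fun_mul hf (η.diffAt hY hZ)
        have h2 := mvfderiv_fun_mul hf (η.diffAt hX hY)
        rw [leviCivitaFun_apply η hfY hX hZ, add_apply, map_add,
          add_apply, smul_apply, map_smul,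
          smul_apply, leviCivitaFun_apply η hY hX hZ]
        simp [koszul, mlieBracket_smul_left hf hY, mlieBracket_smul_right hf hY, h1, h2]
        rw [η.symm x (Y x) (X x)]
        ring }

theorem leviCivita_isLeviCivita : IsLeviCivita η (leviCivita η) where
  torsion_eq_zero := by
    rw [CovariantDerivative.torsion_eq_zero_iff]
    intro X Y x hX hY
    refine η.eq_of_apply fun w ↦ ?_
    have hZ : MDiffAt (T% (FiberBundle.extend E w : ∀ x : M, TangentSpace I x)) x :=
      mdifferentiableAt_extend ..
    have h1 := leviCivitaFun_apply η hY hX hZ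
    have h2 := leviCivitaFun_apply η hX hY hZ
    simp only [FiberBundle.extend_apply_self] at h1 h2
    change η x (leviCivitaFun η Y x (X x) - leviCivitaFun η X x (Y x)) w = _
    rw [map_sub, sub_apply, h1, h2]
    have hs (X Y : ∀ x : M, TangentSpace I x) :
        (fun y ↦ η y (X y) (Y y)) = fun y ↦ η y (Y y) (X y) := funext fun y ↦ η.symm y _ _
    simp only [koszul, hs X Y, mlieBracket_swap_apply (V := Y) (W := X), map_neg,
      FiberBundle.extend_apply_self, neg_apply]
    ring
  metric := by
    intro x Y Z hY hZ v
    have hX : MDiffAt (T% (FiberBundle.extend E v : ∀ x : M, TangentSpace I x)) x :=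
      mdifferentiableAt_extend ..
    have h1 := leviCivitaFun_apply η hY hX hZ
    have h2 := leviCivitaFun_apply η hZ hX hY
    simp only [FiberBundle.extend_apply_self] at h1 h2
    change _ = η x (leviCivitaFun η Y x v) (Z x) + η x (Y x) (leviCivitaFun η Z x v)
    rw [η.symm x (Y x), h1, h2]
    have hs (X Y : ∀ x : M, TangentSpace I x) :
        (fun y ↦ η y (X y) (Y y)) = fun y ↦ η y (Y y) (X y) := funext fun y ↦ η.symm y _ _
    simp only [koszul, hs Z Y, mlieBracket_swap_apply (V := Z) (W := Y), map_neg,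
      FiberBundle.extend_apply_self, neg_apply]
    ring

/-! ### Almost para-Hermitian and almost para-Kähler manifolds -/

section ParaHermitian

variable (K : ∀ x : M, TangentSpace I x →L[ℝ] TangentSpace I x)

/-- `(K, η)` is a para-Hermitian structure on the tangent bundle of the `2d`-dimensional
manifold `M`. -/
structure IsAlmostParaHermitian (d : ℕ) : Prop where
  finrank_eq : finrank ℝ E = 2 * d
  smooth : ContMDiff I (I.prod 𝓘(ℝ, E →L[ℝ] E)) ∞
    (fun x ↦ TotalSpace.mk' (E →L[ℝ] E) (E := fun x : M ↦ TangentSpace I x →L[ℝ] TangentSpace I x)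
      x (K x))
  sq : ∀ x v, K x (K x v) = v
  ne_id : ∀ x, K x ≠ ContinuousLinearMap.id ℝ (TangentSpace I x)
  ne_neg_id : ∀ x, K x ≠ -ContinuousLinearMap.id ℝ (TangentSpace I x)
  finrank_plus : ∀ x, finrank ℝ (End.eigenspace (K x).toLinearMap 1) = d
  finrank_minus : ∀ x, finrank ℝ (End.eigenspace (K x).toLinearMap (-1)) = d
  /-- `η` has split signature `(d, d)` -/
  signature : ∀ x, sigPos (η.bilin x).toQuadraticMap = d ∧ sigNeg (η.bilin x).toQuadraticMap = d
  compatible : ∀ x v w, η x (K x v) (K x w) = -η x v w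

/-- The fundamental two-form `ω(X, Y) = η(KX, Y)`. -/
def fundamentalForm (x : M) (v w : TangentSpace I x) : ℝ := η x (K x v) w

/-- The two-form `σ` is closed: `dσ(X, Y, Z) = 0` for all smooth vector fields, where
`dσ(X, Y, Z) = X σ(Y, Z) + Y σ(Z, X) + Z σ(X, Y) - σ([X, Y], Z) - σ([Y, Z], X) - σ([Z, X], Y)`. -/
def IsClosedTwoForm (σ : ∀ x : M, TangentSpace I x → TangentSpace I x → ℝ) : Prop :=
  ∀ X Y Z : ∀ x : M, TangentSpace I x, Smooth I E X → Smooth I E Y → Smooth I E Z → ∀ x,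
    d% (fun y ↦ σ y (Y y) (Z y)) x (X x) + d% (fun y ↦ σ y (Z y) (X y)) x (Y x)
      + d% (fun y ↦ σ y (X y) (Y y)) x (Z x)
      - σ x (mlieBracket I X Y x) (Z x) - σ x (mlieBracket I Y Z x) (X x)
      - σ x (mlieBracket I Z X x) (Y x) = 0

/-- `(M, K, η)` is an almost para-Kähler manifold of dimension `2d`. -/
structure IsAlmostParaKahler (d : ℕ) : Prop extends IsAlmostParaHermitian η K d where
  closed : IsClosedTwoForm (fundamentalForm η K)

/-! ### The canonical metric algebroid -/

/-- The projection `P₊ = ½ (1 + K)` to the `+1`-eigenbundle of `K`. -/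
def projPlus (x : M) : TangentSpace I x →L[ℝ] TangentSpace I x :=
  (1 / 2 : ℝ) • (ContinuousLinearMap.id ℝ (TangentSpace I x) + K x)

/-- The projection `P₋ = ½ (1 - K)` to the `-1`-eigenbundle of `K`. -/
def projMinus (x : M) : TangentSpace I x →L[ℝ] TangentSpace I x :=
  (1 / 2 : ℝ) • (ContinuousLinearMap.id ℝ (TangentSpace I x) - K x)

/-- The canonical connection `P₊ ∘ ∇ ∘ P₊ + P₋ ∘ ∇ ∘ P₋`, with `∇` the Levi-Civita connection
of `η`; `canonicalConnection η K Y x v` is the derivative of `Y` along `v`. -/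
def canonicalConnection (Y : ∀ x : M, TangentSpace I x) (x : M) :
    TangentSpace I x →L[ℝ] TangentSpace I x :=
  projPlus K x ∘L leviCivita η (fun y ↦ projPlus K y (Y y)) x +
    projMinus K x ∘L leviCivita η (fun y ↦ projMinus K y (Y y)) x

/-- The canonical D-bracket: the vector field `⟦X, Y⟧` with
`η(⟦X, Y⟧, Z) = η(∇_X Y - ∇_Y X, Z) + η(∇_Z X, Y)` for all `Z`, where `∇` is the canonical
connection. -/
def canonicalDBracket (X Y : ∀ x : M, TangentSpace I x) (x : M) : TangentSpace I x :=
  canonicalConnection η K Y x (X x) - canonicalConnection η K X x (Y x) +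
    (η.flat x).symm ((η x (Y x)) ∘L canonicalConnection η K X x)

/-- The canonical metric algebroid `(TM, ⟦·,·⟧^K, η, 1)`. -/
def canonicalAlgebroid : AlgebroidData I (TangentSpace I : M → Type _) where
  fibre _ := ⊤
  bracket := canonicalDBracket η K
  pairing := η.bilin
  anchor _ := LinearMap.id

end ParaHermitian

/-! ### The algebroid on `C₊` -/

/-- The involution `𝓘₀(X + α) = η⁻¹♯ α + η♭ X` of `𝕋M` (the case `b = 0`). -/
def swapInvolution (x : M) : GenTangent I x →ₗ[ℝ] GenTangent I x :=
  LinearMap.prod ((η.flat x).symm.toLinearMap ∘ₗ LinearMap.snd ℝ _ _)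
    ((η.flat x).toLinearMap ∘ₗ LinearMap.fst ℝ _ _)

/-- `C₊`, the `+1`-eigenbundle of `𝓘₀`. -/
def Cplus (x : M) : Submodule ℝ (GenTangent I x) := End.eigenspace (swapInvolution η x) 1

/-- `C₊` is the graph of `η♭`. -/
lemma mem_Cplus {x : M} {p : GenTangent I x} : p ∈ Cplus η x ↔ p.2 = η.flat x p.1 := by
  rw [Cplus, End.mem_eigenspace_iff, one_smul, Prod.ext_iff]
  change (η.flat x).symm p.2 = p.1 ∧ η.flat x p.1 = p.2 ↔ _
  constructor
  · exact fun h ↦ h.2.symm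
  · intro h
    simp [h]

/-- The projection `p₊ = ½ (1 + 𝓘₀)` of `𝕋M = C₊ ⊕ C₋` to `C₊`. -/
def pPlus (x : M) : GenTangent I x →ₗ[ℝ] GenTangent I x :=
  (1 / 2 : ℝ) • (LinearMap.id + swapInvolution η x)

/-- The algebroid `(C₊, ⟦·,·⟧⁺, ⟨·,·⟩, ρ₊)` obtained from the large Courant algebroid:
`⟦ξ, ξ'⟧⁺ = p₊ [ξ, ξ']`, `⟨ξ, ξ'⟩ = ½ ⟨ξ, ξ'⟩_𝕋M`, and `ρ₊` the restriction of `ρ` to `C₊`. -/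
def plusAlgebroid : AlgebroidData I (GenTangent I : M → Type _) where
  fibre := Cplus η
  bracket s t x := pPlus η x (largeCourant.bracket s t x)
  pairing x := (1 / 2 : ℝ) • largeCourant.pairing x
  anchor := largeCourant.anchor

/-- The fibrewise linear isomorphism `ρ₊ : C₊ → TM`. -/
def rhoPlus (x : M) : Cplus η x ≃ₗ[ℝ] TangentSpace I x :=
  LinearEquiv.ofBijective ((plusAlgebroid η).anchor x ∘ₗ (Cplus η x).subtype) <| by
    constructor
    · rintro ⟨p, hp⟩ ⟨q, hq⟩ h
      have h' : p.1 = q.1 := h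
      rw [mem_Cplus] at hp hq
      exact Subtype.ext (Prod.ext h' (by rw [hp, hq, h']))
    · exact fun v ↦ ⟨⟨(v, η.flat x v), (mem_Cplus η).2 rfl⟩, rfl⟩

/-- The endomorphism `K - Kᵗ` of `𝕋M = TM ⊕ T*M`, `X + α ↦ K X - α ∘ K`. -/
def doubledEndo (K : ∀ x : M, TangentSpace I x →L[ℝ] TangentSpace I x) (x : M) :
    GenTangent I x →ₗ[ℝ] GenTangent I x where
  toFun p := (K x p.1, -(p.2 ∘L K x))
  map_add' p q := by ext <;> simp [add_comm]
  map_smul' c p := by ext <;> simp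

/-- `K' = ρ₊ ∘ (K - Kᵗ) ∘ ρ₊⁻¹`. -/
def inducedParaComplex (K : ∀ x : M, TangentSpace I x →L[ℝ] TangentSpace I x) (x : M) :
    TangentSpace I x →L[ℝ] TangentSpace I x :=
  LinearMap.toContinuousLinearMap <|
    (plusAlgebroid η).anchor x ∘ₗ doubledEndo K x ∘ₗ (Cplus η x).subtype ∘ₗ
      (rhoPlus η x).symm.toLinearMap

end DoubledGeometry

end

/-!
The proof compares both brackets with a third one, the D-bracket of the Levi-Civita connection `∇`
of `η`, `η(⟦X, Y⟧, Z) = η(∇_X Y - ∇_Y X, Z) + η(∇_Z X, Y)` (`leviCivitaDBracket`).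

* The tangent bundle with this bracket, the pairing `η` and the identity as anchor is a metric
  algebroid (`isMetricAlgebroid_leviCivitaAlgebroid`): each axiom is a pointwise consequence of the
  Leibniz rule and of metric compatibility, and the bracket of smooth fields is smooth because `∇`
  is given by Koszul's formula and the musical isomorphism detects smoothness.
* For arbitrary `η`, expanding the Lie derivative and the exterior derivative of one-forms with `∇`
  shows that the anchor carries the projected Dorfman bracket on `C₊`, the graph of `η♭`, to the
  D-bracket of `∇` (`pPlus_dorfman_fst`, `isMetricAlgebroidIso_anchor`).
* The canonical connection satisfies
  `η(∇ᶜ_X Y, Z) = η(∇_X Y, Z) - ½ (∇_X ω)(Y, KZ)`, so its D-bracket differs from that of `∇`, after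
  pairing with `Z`, by `-½` times the cyclic sum of `(∇_X ω)(Y, KZ)`. Since `∇` is torsion-free, `dω` is the cyclic sum of `∇ω`; since
  `∇K` anticommutes with `K`, the first cyclic sum is a combination of values of `dω` on vector
  fields some of which are rotated by `K`. Hence `dω = 0` makes the two brackets agree
  (`IsAlmostParaKahler.canonicalDBracket_eq`).

The metric algebroid axioms for `C₊` and for the canonical algebroid are pulled back from those of
`leviCivitaAlgebroid` (`IsMetricAlgebroidIso.isMetricAlgebroid`). Finally `K' = K`
(`inducedParaComplex_eq`).
-/

namespace DoubledGeometry

/-! ### Smooth vector fields and one-forms -/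

section Smoothness

variable {E : Type*} [NormedAddCommGroup E] [NormedSpace ℝ E]
  {H : Type*} [TopologicalSpace H] {I : ModelWithCorners ℝ E H}
  {M : Type*} [TopologicalSpace M] [ChartedSpace H M] [IsManifold I ∞ M]

lemma SmoothAt.mdifferentiableAt {X : ∀ x : M, TangentSpace I x} {x : M}
    (hX : SmoothAt I E X x) : MDiffAt (T% X) x :=
  ContMDiffAt.mdifferentiableAt (n := ∞) hX (by simp)

lemma smooth_deriv {f : M → ℝ} (hf : ContMDiff I 𝓘(ℝ, ℝ) ∞ f) {X : ∀ x : M, TangentSpace I x}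
    (hX : Smooth I E X) : ContMDiff I 𝓘(ℝ, ℝ) ∞ (fun x ↦ d% f x (X x)) := by
  have h := (hf.contMDiff_tangentMap (m := ∞) (by simp)).comp (show ContMDiff _ _ _ _ from hX)
  intro x
  have := (contMDiffAt_totalSpace.1 (h x)).2
  simp [tangentMap] at this
  exact this

lemma smoothAt_prod_iff {X : ∀ x : M, TangentSpace I x} {α : ∀ x : M, Cotangent I x} {x : M} :
    SmoothAt I (E × (E →L[ℝ] ℝ)) (V := (GenTangent I : M → Type _)) (fun y ↦ (X y, α y)) x ↔
      SmoothAt I E X x ∧ SmoothAt I (E →L[ℝ] ℝ) α x := by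
  simp only [SmoothAt, contMDiffAt_section]
  exact contMDiffAt_prod_module_iff _

lemma SmoothAt.apply {α : ∀ x : M, Cotangent I x} {X : ∀ x : M, TangentSpace I x} {x : M}
    (hα : SmoothAt I (E →L[ℝ] ℝ) α x) (hX : SmoothAt I E X x) :
    ContMDiffAt I 𝓘(ℝ, ℝ) ∞ (fun y ↦ α y (X y)) x := by
  have := ContMDiffAt.clm_bundle_apply (F₁ := E) (F₂ := ℝ)
    (E₁ := (TangentSpace I : M → Type _)) (E₂ := Bundle.Trivial M ℝ) (b := fun y ↦ y)
    (ϕ := α) (v := X) hα hX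
  simpa using (contMDiffAt_totalSpace.1 this).2

lemma PseudoRiemannianMetric.smoothAt_flat (η : PseudoRiemannianMetric I M)
    {X : ∀ x : M, TangentSpace I x} {x : M}
    (hX : SmoothAt I E X x) : SmoothAt I (E →L[ℝ] ℝ) (fun y ↦ η y (X y)) x :=
  ContMDiffAt.clm_bundle_apply (F₁ := E) (F₂ := E →L[ℝ] ℝ)
    (E₁ := (TangentSpace I : M → Type _))
    (E₂ := (Cotangent I : M → Type _)) (b := fun y ↦ y) (ϕ := η.toFun) (v := X)
    (η.contMDiff x) hX

variable [CompleteSpace E] in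
lemma smooth_mlieBracket {X Y : ∀ x : M, TangentSpace I x} (hX : Smooth I E X)
    (hY : Smooth I E Y) : Smooth I E (mlieBracket I X Y) := by
  have : IsManifold I (((⊤ : ℕ∞) : ℕ∞ω) + 1) M := by simpa using ‹IsManifold I ∞ M›
  have : IsManifold I (minSmoothness ℝ 2) M :=
    IsManifold.of_le (n := ∞) (by simpa using WithTop.coe_le_coe.2 (le_top : (2 : ℕ∞) ≤ ⊤))
  have : IsManifold I (minSmoothness ℝ 3) M :=
    IsManifold.of_le (n := ∞) (by simpa using WithTop.coe_le_coe.2 (le_top : (3 : ℕ∞) ≤ ⊤))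
  intro x
  exact ContMDiffAt.mlieBracket_vectorField (m := ⊤) (n := ⊤) (hX x) (hY x) (by simp)

variable [FiniteDimensional ℝ E]

/-- A vector field which is smooth on an open set agrees near any point of it with a global smooth
vector field: multiply by a bump function. -/
lemma exists_smooth_eventuallyEq [T2Space M] {U : Set M} (hU : IsOpen U) {x : M} (hx : x ∈ U)
    {s : ∀ x : M, TangentSpace I x} (hs : ∀ y ∈ U, SmoothAt I E s y) :
    ∃ S : ∀ x : M, TangentSpace I x, Smooth I E S ∧ ∀ᶠ y in 𝓝 x, S y = s y := by
  obtain ⟨f, -, hf⟩ := (SmoothBumpFunction.nhds_basis_tsupport (I := I) x).mem_iff.1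
    (hU.mem_nhds hx)
  refine ⟨fun y ↦ f y • s y, ?_, ?_⟩
  · exact ContMDiffOn.smul_section_of_tsupport (n := ∞) f.contMDiff.contMDiffOn hU hf
      (fun y hy ↦ (hs y hy).contMDiffWithinAt)
  · filter_upwards [f.eventuallyEq_one] with y hy
    simp [hy]

/-- Smooth functions of the form `y ↦ α (Z y)`, with `Z` a smooth vector field, detect the
smoothness of a one-form `α`. -/
lemma smoothAt_cotangent_of_apply [T2Space M] {α : ∀ x : M, Cotangent I x} {x : M}
    (h : ∀ Z : ∀ x : M, TangentSpace I x, Smooth I E Z →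
      ContMDiffAt I 𝓘(ℝ, ℝ) ∞ (fun y ↦ α y (Z y)) x) :
    SmoothAt I (E →L[ℝ] ℝ) α x := by
  set e := trivializationAt E (TangentSpace I : M → Type _) x
  let b := Module.finBasis ℝ E
  have hxe : x ∈ e.baseSet := mem_baseSet_trivializationAt' x
  have hframe (i) : ContMDiffAt I 𝓘(ℝ, ℝ) ∞ (fun y ↦ α y (e.localFrame b i y)) x := by
    obtain ⟨S, hS, hSe⟩ := exists_smooth_eventuallyEq (I := I) e.open_baseSet hxe
      (s := e.localFrame b i) (fun y hy ↦ contMDiffAt_localFrame_of_mem ∞ e b i hy)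
    refine (h S hS).congr_of_eventuallyEq ?_
    filter_upwards [hSe] with y hy
    rw [hy]
  refine (contMDiffAt_hom_bundle _).2 ⟨contMDiffAt_id, ?_⟩
  -- In the trivialization, `α` is the sum of its values on the local frame times the dual basis.
  have hsum : ContMDiffAt I 𝓘(ℝ, E →L[ℝ] ℝ) ∞ (fun y ↦ ∑ i, α y (e.localFrame b i y) •
      LinearMap.toContinuousLinearMap (b.coord i)) x :=
    ContMDiffAt.sum fun i _ ↦ (hframe i).smul contMDiffAt_const
  refine hsum.congr_of_eventuallyEq ?_
  filter_upwards [e.open_baseSet.mem_nhds hxe] with y hy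
  refine ContinuousLinearMap.coe_injective (b.ext fun i ↦ ?_)
  rw [ContinuousLinearMap.coe_coe, ContinuousLinearMap.inCoordinates_eq hy (by simp)]
  simp [Finsupp.single_apply, e.localFrame_apply_of_mem_baseSet b hy, Trivialization.basisAt]
  rfl

/-- Every tangent vector is the value of a global smooth vector field. -/
lemma exists_smooth_extension [T2Space M] {x : M} (v : TangentSpace I x) :
    ∃ S : ∀ x : M, TangentSpace I x, Smooth I E S ∧ S x = v := by
  obtain ⟨s, hs, hsv⟩ := exists_contMDiffOn_extend (k := ∞) I E v
  obtain ⟨U, hUs, hU, hxU⟩ := mem_nhds_iff.1 hs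
  obtain ⟨S, hS, hSe⟩ := exists_smooth_eventuallyEq (I := I) hU hxU (s := extend E v)
    (fun y hy ↦ (hsv.mono hUs).contMDiffAt (hU.mem_nhds hy))
  exact ⟨S, hS, by simpa using hSe.self_of_nhds⟩

/-- A vector field is smooth where its metric dual is: in a trivialization, the inverse of the
invertible matrix of the metric depends smoothly on the point. -/
lemma PseudoRiemannianMetric.smoothAt_of_flat (η : PseudoRiemannianMetric I M)
    {X : ∀ x : M, TangentSpace I x} {x : M}
    (hX : SmoothAt I (E →L[ℝ] ℝ) (fun y ↦ η y (X y)) x) : SmoothAt I E X x := by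
  have : CompleteSpace E := FiniteDimensional.complete ℝ E
  set e := trivializationAt E (TangentSpace I : M → Type _) x
  set e' := trivializationAt (E →L[ℝ] ℝ) (Cotangent I : M → Type _) x
  have hxe : x ∈ e.baseSet := mem_baseSet_trivializationAt' x
  have hxe' : x ∈ e'.baseSet := mem_baseSet_trivializationAt' x
  have hη := ((contMDiffAt_hom_bundle _).1 (η.contMDiff x)).2
  -- `Φ` is the musical isomorphism read in the trivializations around `x`.
  set Φ : M → E →L[ℝ] E →L[ℝ] ℝ := fun y ↦ ContinuousLinearMap.inCoordinates E (TangentSpace I)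
    (E →L[ℝ] ℝ) (Cotangent I) x y x y (η y) with hΦ
  change ContMDiffAt I 𝓘(ℝ, E →L[ℝ] E →L[ℝ] ℝ) ∞ Φ x at hη
  have hΦe (y) (hy : y ∈ e.baseSet) (hy' : y ∈ e'.baseSet) :
      Φ y = ((e.continuousLinearEquivAt ℝ y hy).symm.trans
        ((η.flat y).toContinuousLinearEquiv.trans (e'.continuousLinearEquivAt ℝ y hy')) :
          E ≃L[ℝ] E →L[ℝ] ℝ) := by
    rw [hΦ]
    simp only
    rw [ContinuousLinearMap.inCoordinates_eq hy hy']
    rfl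
  have hinv : ContMDiffAt I 𝓘(ℝ, (E →L[ℝ] ℝ) →L[ℝ] E) ∞ (fun y ↦ (Φ y).inverse) x := by
    have h1 : ContDiffAt ℝ ∞ ContinuousLinearMap.inverse (Φ x) := by
      rw [hΦe x hxe hxe']
      exact contDiffAt_map_inverse _
    exact h1.contMDiffAt.comp x hη
  simp only [SmoothAt, contMDiffAt_section] at hX ⊢
  refine (hinv.clm_apply hX).congr_of_eventuallyEq ?_
  filter_upwards [e.open_baseSet.mem_nhds hxe, e'.open_baseSet.mem_nhds hxe'] with y hy hy'
  rw [hΦe y hy hy', ContinuousLinearMap.inverse_equiv]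
  change e.continuousLinearEquivAt ℝ y hy (X y) =
    e.continuousLinearEquivAt ℝ y hy ((η.flat y).symm
      ((e'.continuousLinearEquivAt ℝ y hy').symm
        (e'.continuousLinearEquivAt ℝ y hy' (η.flat y (X y)))))
  rw [ContinuousLinearEquiv.symm_apply_apply, LinearEquiv.symm_apply_apply]

end Smoothness

/-! ### The D-bracket of the Levi-Civita connection -/

noncomputable section LeviCivita

variable {E : Type*} [NormedAddCommGroup E] [NormedSpace ℝ E] [FiniteDimensional ℝ E]
  {H : Type*} [TopologicalSpace H] {I : ModelWithCorners ℝ E H}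
  {M : Type*} [TopologicalSpace M] [ChartedSpace H M] [IsManifold I ∞ M]
  (η : PseudoRiemannianMetric I M)

lemma leviCivita_sub {X Y : ∀ x : M, TangentSpace I x} {x : M} (hX : MDiffAt (T% X) x)
    (hY : MDiffAt (T% Y) x) :
    leviCivita η Y x (X x) - leviCivita η X x (Y x) = mlieBracket I X Y x :=
  ((leviCivita η).torsion_eq_zero_iff).1 (leviCivita_isLeviCivita η).torsion_eq_zero hX hY

lemma leviCivita_metric {Y Z : ∀ x : M, TangentSpace I x} {x : M} (hY : MDiffAt (T% Y) x)
    (hZ : MDiffAt (T% Z) x) (v : TangentSpace I x) :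
    d% (fun y ↦ η y (Y y) (Z y)) x v =
      η x (leviCivita η Y x v) (Z x) + η x (Y x) (leviCivita η Z x v) :=
  (leviCivita_isLeviCivita η).metric x Y Z hY hZ v

lemma leviCivita_add {Y Y' : ∀ x : M, TangentSpace I x} {x : M} (hY : MDiffAt (T% Y) x)
    (hY' : MDiffAt (T% Y') x) :
    leviCivita η (Y + Y') x = leviCivita η Y x + leviCivita η Y' x :=
  (leviCivita η).isCovariantDerivativeOnUniv.add hY hY'

lemma leviCivita_smul {Y : ∀ x : M, TangentSpace I x} {f : M → ℝ} {x : M}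
    (hY : MDiffAt (T% Y) x) (hf : MDiffAt f x) :
    leviCivita η (f • Y) x = f x • leviCivita η Y x + (d% f x).smulRight (Y x) :=
  (leviCivita η).isCovariantDerivativeOnUniv.leibniz hY hf

lemma leviCivita_const_smul {Y : ∀ x : M, TangentSpace I x} {x : M} (c : ℝ)
    (hY : MDiffAt (T% Y) x) : leviCivita η (c • Y) x = c • leviCivita η Y x :=
  (leviCivita η).isCovariantDerivativeOnUniv.smul_const c hY

lemma PseudoRiemannianMetric.smoothAt_apply {X Y : ∀ x : M, TangentSpace I x} {x : M}
    (hX : SmoothAt I E X x) (hY : SmoothAt I E Y x) :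
    ContMDiffAt I 𝓘(ℝ, ℝ) ∞ (fun y ↦ η y (X y) (Y y)) x :=
  (η.smoothAt_flat hX).apply hY

lemma PseudoRiemannianMetric.smooth_apply {X Y : ∀ x : M, TangentSpace I x}
    (hX : Smooth I E X) (hY : Smooth I E Y) :
    ContMDiff I 𝓘(ℝ, ℝ) ∞ (fun y ↦ η y (X y) (Y y)) :=
  fun x ↦ η.smoothAt_apply (hX x) (hY x)

/-- A vector field is smooth if its products with all smooth vector fields are smooth. -/
lemma PseudoRiemannianMetric.smooth_of_apply [T2Space M] {X : ∀ x : M, TangentSpace I x}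
    (h : ∀ Z : ∀ x : M, TangentSpace I x, Smooth I E Z →
      ContMDiff I 𝓘(ℝ, ℝ) ∞ (fun y ↦ η y (X y) (Z y))) : Smooth I E X :=
  fun x ↦ η.smoothAt_of_flat (smoothAt_cotangent_of_apply fun Z hZ ↦ h Z hZ x)

/-- `∇_X Y` is smooth, since all terms of Koszul's formula are. -/
lemma smooth_leviCivita [T2Space M] {X Y : ∀ x : M, TangentSpace I x} (hX : Smooth I E X)
    (hY : Smooth I E Y) : Smooth I E (fun x ↦ leviCivita η Y x (X x)) := by
  have : CompleteSpace E := FiniteDimensional.complete ℝ E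
  refine η.smooth_of_apply fun Z hZ ↦ ?_
  have h (x) : η x (leviCivita η Y x (X x)) (Z x) = koszul η Y x X Z :=
    leviCivitaFun_apply η (hY x).mdifferentiableAt (hX x).mdifferentiableAt
      (hZ x).mdifferentiableAt
  simp only [h, koszul, div_eq_mul_inv]
  have hd {A B C : ∀ x : M, TangentSpace I x} (hA : Smooth I E A) (hB : Smooth I E B)
      (hC : Smooth I E C) := smooth_deriv (η.smooth_apply hA hB) hC
  have hb {A B C : ∀ x : M, TangentSpace I x} (hA : Smooth I E A) (hB : Smooth I E B)
      (hC : Smooth I E C) := η.smooth_apply (smooth_mlieBracket hA hB) hC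
  exact ((((((hd hY hZ hX).add (hd hX hZ hY)).sub (hd hX hY hZ)).add (hb hX hY hZ)).sub
    (hb hX hZ hY)).sub (hb hY hZ hX)).mul contMDiff_const

/-- The D-bracket of the Levi-Civita connection: the vector field `⟦X, Y⟧` with
`η(⟦X, Y⟧, Z) = η(∇_X Y - ∇_Y X, Z) + η(∇_Z X, Y)` for all `Z`. -/
def leviCivitaDBracket (X Y : ∀ x : M, TangentSpace I x) (x : M) : TangentSpace I x :=
  leviCivita η Y x (X x) - leviCivita η X x (Y x) +
    (η.flat x).symm ((η x (Y x)) ∘L leviCivita η X x)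

lemma apply_leviCivitaDBracket (X Y : ∀ x : M, TangentSpace I x) (x : M) (v : TangentSpace I x) :
    η x (leviCivitaDBracket η X Y x) v =
      η x (leviCivita η Y x (X x)) v - η x (leviCivita η X x (Y x)) v +
        η x (Y x) (leviCivita η X x v) := by
  simp [leviCivitaDBracket, η.apply_flat_symm]

lemma smooth_leviCivitaDBracket [T2Space M] {X Y : ∀ x : M, TangentSpace I x}
    (hX : Smooth I E X) (hY : Smooth I E Y) : Smooth I E (leviCivitaDBracket η X Y) := by
  refine η.smooth_of_apply fun Z hZ ↦ ?_
  simp only [apply_leviCivitaDBracket]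
  exact ((η.smooth_apply (smooth_leviCivita η hX hY) hZ).sub
    (η.smooth_apply (smooth_leviCivita η hY hX) hZ)).add
      (η.smooth_apply hY (smooth_leviCivita η hZ hX))

/-- The tangent bundle with the D-bracket of the Levi-Civita connection. -/
def leviCivitaAlgebroid : AlgebroidData I (TangentSpace I : M → Type _) where
  fibre _ := ⊤
  bracket := leviCivitaDBracket η
  pairing := η.bilin
  anchor _ := LinearMap.id

variable (I M) in
/-- The tangent bundle has a smooth frame near every point. -/
lemma exists_smooth_frame (x₀ : M) : ∃ U : Set M, IsOpen U ∧ x₀ ∈ U ∧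
    ∃ (n : ℕ) (b : Fin n → ∀ x : M, TangentSpace I x), ∀ x ∈ U, (∀ i, SmoothAt I E (b i) x) ∧
      LinearIndependent ℝ (fun i ↦ b i x) ∧ Submodule.span ℝ (Set.range fun i ↦ b i x) = ⊤ := by
  have h := (trivializationAt E (TangentSpace I : M → Type _) x₀).isLocalFrameOn_localFrame_baseSet
    I ∞ (Module.finBasis ℝ E)
  have ho := (trivializationAt E (TangentSpace I : M → Type _) x₀).open_baseSet
  exact ⟨_, ho, mem_baseSet_trivializationAt' x₀, _, _, fun x hx ↦
    ⟨fun i ↦ h.contMDiffAt ho hx i, h.linearIndependent hx, top_le_iff.1 (h.generating hx)⟩⟩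

lemma isMetricAlgebroid_leviCivitaAlgebroid [T2Space M] :
    IsMetricAlgebroid E (leviCivitaAlgebroid η) where
  subbundle := exists_smooth_frame I M
  anchor_smooth e _ x he := he
  pairing_smooth e₁ e₂ _ _ x h₁ h₂ := η.smoothAt_apply h₁ h₂
  pairing_symm x v _ w _ := η.symm x v w
  pairing_nondegenerate x v _ h := η.nondegenerate x v fun w ↦ h w trivial
  bracket_mem e₁ h₁ e₂ h₂ := ⟨fun _ ↦ trivial, smooth_leviCivitaDBracket η h₁.2 h₂.2⟩
  bracket_add_left e₁ h₁ e₂ h₂ e he := by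
    funext x
    refine η.eq_of_apply fun w ↦ ?_
    simp only [leviCivitaAlgebroid, Pi.add_apply, map_add, add_apply, apply_leviCivitaDBracket,
      leviCivita_add η (h₁.2 x).mdifferentiableAt (h₂.2 x).mdifferentiableAt]
    ring
  bracket_add_right e he e₁ h₁ e₂ h₂ := by
    funext x
    refine η.eq_of_apply fun w ↦ ?_
    simp only [leviCivitaAlgebroid, Pi.add_apply, map_add, add_apply, apply_leviCivitaDBracket,
      leviCivita_add η (h₁.2 x).mdifferentiableAt (h₂.2 x).mdifferentiableAt]
    ring
  bracket_smul_left c e₁ h₁ e₂ h₂ := by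
    funext x
    refine η.eq_of_apply fun w ↦ ?_
    simp only [leviCivitaAlgebroid, Pi.smul_apply, map_smul, smul_apply, apply_leviCivitaDBracket,
      leviCivita_const_smul η c (h₁.2 x).mdifferentiableAt, smul_eq_mul]
    ring
  bracket_smul_right c e₁ h₁ e₂ h₂ := by
    funext x
    refine η.eq_of_apply fun w ↦ ?_
    simp only [leviCivitaAlgebroid, Pi.smul_apply, map_smul, smul_apply, apply_leviCivitaDBracket,
      leviCivita_const_smul η c (h₂.2 x).mdifferentiableAt, smul_eq_mul]
    ring
  anchored_derivation e he e' he' f hf x := by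
    refine η.eq_of_apply fun w ↦ ?_
    have h := leviCivita_smul η (he'.2 x).mdifferentiableAt ((hf x).mdifferentiableAt (by simp))
    change leviCivita η (fun y ↦ f y • e' y) x = _ at h
    simp only [leviCivitaAlgebroid, map_add, add_apply, map_smul, smul_apply,
      apply_leviCivitaDBracket, h, smul_eq_mul, AlgebroidData.deriv, LinearMap.id_apply,
      ContinuousLinearMap.smulRight_apply]
    ring
  bracket_metric e he e₁ h₁ e₂ h₂ x := by
    have h := leviCivita_metric η (h₁.2 x).mdifferentiableAt (h₂.2 x).mdifferentiableAt (e x)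
    change d% (fun y ↦ η y (e₁ y) (e₂ y)) x (e x) = η x (leviCivitaDBracket η e e₁ x) (e₂ x) +
      η x (e₁ x) (leviCivitaDBracket η e e₂ x)
    rw [h, η.symm x (e₁ x) (leviCivitaDBracket η e e₂ x)]
    simp only [apply_leviCivitaDBracket]
    rw [η.symm x (e₁ x) (leviCivita η e₂ x (e x)), η.symm x (e₁ x) (leviCivita η e x (e₂ x)),
      η.symm x (e₂ x) (leviCivita η e x (e₁ x))]
    ring
  bracket_self e he e₁ h₁ x := by
    have h := leviCivita_metric η (he.2 x).mdifferentiableAt (he.2 x).mdifferentiableAt (e₁ x)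
    change η x (leviCivitaDBracket η e e x) (e₁ x) =
      (1 / 2) * d% (fun y ↦ η y (e y) (e y)) x (e₁ x)
    rw [h, apply_leviCivitaDBracket, η.symm x (leviCivita η e x (e₁ x)) (e x)]
    ring

end LeviCivita

/-! ### Transport of the metric algebroid axioms along isomorphisms -/

section Transport

variable {E : Type*} [NormedAddCommGroup E] [NormedSpace ℝ E]
  {H : Type*} [TopologicalSpace H] {I : ModelWithCorners ℝ E H}
  {M : Type*} [TopologicalSpace M] [ChartedSpace H M] [IsManifold I ∞ M]
  {F : Type*} [NormedAddCommGroup F] [NormedSpace ℝ F]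
  {V : M → Type*} [TopologicalSpace (TotalSpace F V)] [∀ x, AddCommGroup (V x)]
  [∀ x, Module ℝ (V x)] [∀ x, TopologicalSpace (V x)] [FiberBundle F V]

/-- The axioms of a metric algebroid pull back along an isomorphism to an algebroid on a subbundle
of the tangent bundle. -/
lemma IsMetricAlgebroidIso.isMetricAlgebroid {A : AlgebroidData I V}
    {A' : AlgebroidData I (TangentSpace I : M → Type _)} {ψ : ∀ x : M, V x →ₗ[ℝ] TangentSpace I x}
    (hψ : IsMetricAlgebroidIso F E A A' ψ) (hA' : IsMetricAlgebroid E A')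
    (hA : IsSmoothSubbundle I F A.fibre)
    (hbr : ∀ e₁ ∈ A.sections F, ∀ e₂ ∈ A.sections F, ∀ x, A.bracket e₁ e₂ x ∈ A.fibre x) :
    IsMetricAlgebroid F A := by
  have hmem {e : ∀ x : M, V x} (he : e ∈ A.sections F) :
      (fun y ↦ ψ y (e y)) ∈ A'.sections E :=
    ⟨fun x ↦ (hψ.bijOn x).mapsTo (he.1 x), fun x ↦ (hψ.smooth_iff e he.1 x).2 (he.2 x)⟩
  have hsmooth {e : ∀ x : M, V x} (he : ∀ x, e x ∈ A.fibre x)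
      (h : Smooth I E (fun y ↦ ψ y (e y))) : e ∈ A.sections F :=
    ⟨he, fun x ↦ (hψ.smooth_iff e he x).1 (h x)⟩
  have hbracket {e₁ e₂ : ∀ x : M, V x} (h₁ : e₁ ∈ A.sections F) (h₂ : e₂ ∈ A.sections F) :
      A.bracket e₁ e₂ ∈ A.sections F := by
    refine hsmooth (hbr e₁ h₁ e₂ h₂) ?_
    simp only [hψ.map_bracket e₁ h₁ e₂ h₂]
    exact (hA'.bracket_mem _ (hmem h₁) _ (hmem h₂)).2
  have hadd {e₁ e₂ : ∀ x : M, V x} (h₁ : e₁ ∈ A.sections F) (h₂ : e₂ ∈ A.sections F) :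
      e₁ + e₂ ∈ A.sections F := by
    refine hsmooth (fun x ↦ add_mem (h₁.1 x) (h₂.1 x)) ?_
    simp only [Pi.add_apply, map_add]
    exact fun x ↦ ContMDiffAt.add_section (n := ∞) ((hmem h₁).2 x) ((hmem h₂).2 x)
  have hmul {f : M → ℝ} (hf : ContMDiff I 𝓘(ℝ, ℝ) ∞ f) {e : ∀ x : M, V x}
      (he : e ∈ A.sections F) : (fun y ↦ f y • e y) ∈ A.sections F := by
    refine hsmooth (fun x ↦ Submodule.smul_mem _ _ (he.1 x)) ?_
    simp only [map_smul]
    exact fun x ↦ ContMDiffAt.smul_section (n := ∞) (hf x) ((hmem he).2 x)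
  have hsmul (c : ℝ) {e : ∀ x : M, V x} (he : e ∈ A.sections F) : c • e ∈ A.sections F :=
    hmul (f := fun _ ↦ c) contMDiff_const he
  have hderiv (e : ∀ x : M, V x) (he : ∀ x, e x ∈ A.fibre x) (f : M → ℝ) (x : M) :
      A'.deriv (fun y ↦ ψ y (e y)) f x = A.deriv e f x := by
    rw [AlgebroidData.deriv, hψ.anchor_comp x _ (he x), AlgebroidData.deriv]
  have hpair (e₁ e₂ : ∀ x : M, V x) (h₁ : ∀ x, e₁ x ∈ A.fibre x) (h₂ : ∀ x, e₂ x ∈ A.fibre x) :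
      (fun y ↦ A.pairing y (e₁ y) (e₂ y)) =
        fun y ↦ A'.pairing y (ψ y (e₁ y)) (ψ y (e₂ y)) :=
    funext fun y ↦ (hψ.isometry y _ (h₁ y) _ (h₂ y)).symm
  have hinj {s t : ∀ x : M, V x} (hs : s ∈ A.sections F) (ht : t ∈ A.sections F)
      (h : ∀ x, ψ x (s x) = ψ x (t x)) : s = t :=
    funext fun x ↦ (hψ.bijOn x).injOn (hs.1 x) (ht.1 x) (h x)
  refine ⟨hA, fun e he x hx ↦ ?_, fun e₁ e₂ h₁ h₂ x hx₁ hx₂ ↦ ?_, fun x v hv w hw ↦ ?_,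
    fun x v hv h ↦ ?_, fun e₁ h₁ e₂ h₂ ↦ hbracket h₁ h₂, fun e₁ h₁ e₂ h₂ e he ↦ ?_,
    fun e he e₁ h₁ e₂ h₂ ↦ ?_, fun c e₁ h₁ e₂ h₂ ↦ ?_, fun c e₁ h₁ e₂ h₂ ↦ ?_,
    fun e he e' he' f hf x ↦ ?_, fun e he e₁ h₁ e₂ h₂ x ↦ ?_, fun e he e₁ h₁ x ↦ ?_⟩
  · have := hA'.anchor_smooth _ (fun x ↦ (hψ.bijOn x).mapsTo (he x)) x
      ((hψ.smooth_iff e he x).2 hx)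
    exact (funext fun y ↦ hψ.anchor_comp y _ (he y) :
      (fun y ↦ A'.anchor y (ψ y (e y))) = _) ▸ this
  · rw [hpair e₁ e₂ h₁ h₂]
    exact hA'.pairing_smooth _ _ (fun x ↦ (hψ.bijOn x).mapsTo (h₁ x))
      (fun x ↦ (hψ.bijOn x).mapsTo (h₂ x)) x ((hψ.smooth_iff _ h₁ x).2 hx₁)
      ((hψ.smooth_iff _ h₂ x).2 hx₂)
  · rw [← hψ.isometry x v hv w hw, ← hψ.isometry x w hw v hv]
    exact hA'.pairing_symm x _ ((hψ.bijOn x).mapsTo hv) _ ((hψ.bijOn x).mapsTo hw)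
  · refine (hψ.bijOn x).injOn hv (zero_mem _) ?_
    rw [map_zero]
    refine hA'.pairing_nondegenerate x _ ((hψ.bijOn x).mapsTo hv) fun w' hw' ↦ ?_
    obtain ⟨w, hw, rfl⟩ := (hψ.bijOn x).surjOn hw'
    rw [hψ.isometry x v hv w hw, h w hw]
  · refine hinj (hbracket (hadd h₁ h₂) he) (hadd (hbracket h₁ he) (hbracket h₂ he)) fun x ↦ ?_
    rw [Pi.add_apply, map_add, hψ.map_bracket _ (hadd h₁ h₂) _ he, hψ.map_bracket _ h₁ _ he,
      hψ.map_bracket _ h₂ _ he, ← Pi.add_apply (f := A'.bracket _ _),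
      ← hA'.bracket_add_left _ (hmem h₁) _ (hmem h₂) _ (hmem he)]
    simp only [Pi.add_apply, map_add]
    rfl
  · refine hinj (hbracket he (hadd h₁ h₂)) (hadd (hbracket he h₁) (hbracket he h₂)) fun x ↦ ?_
    rw [Pi.add_apply, map_add, hψ.map_bracket _ he _ (hadd h₁ h₂), hψ.map_bracket _ he _ h₁,
      hψ.map_bracket _ he _ h₂, ← Pi.add_apply (f := A'.bracket _ _),
      ← hA'.bracket_add_right _ (hmem he) _ (hmem h₁) _ (hmem h₂)]
    simp only [Pi.add_apply, map_add]
    rfl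
  · refine hinj (hbracket (hsmul c h₁) h₂) (hsmul c (hbracket h₁ h₂)) fun x ↦ ?_
    rw [Pi.smul_apply, map_smul, hψ.map_bracket _ (hsmul c h₁) _ h₂, hψ.map_bracket _ h₁ _ h₂,
      ← Pi.smul_apply c (A'.bracket _ _), ← hA'.bracket_smul_left c _ (hmem h₁) _ (hmem h₂)]
    simp only [Pi.smul_apply, map_smul]
    rfl
  · refine hinj (hbracket h₁ (hsmul c h₂)) (hsmul c (hbracket h₁ h₂)) fun x ↦ ?_
    rw [Pi.smul_apply, map_smul, hψ.map_bracket _ h₁ _ (hsmul c h₂), hψ.map_bracket _ h₁ _ h₂,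
      ← Pi.smul_apply c (A'.bracket _ _), ← hA'.bracket_smul_right c _ (hmem h₁) _ (hmem h₂)]
    simp only [Pi.smul_apply, map_smul]
    rfl
  · refine (hψ.bijOn x).injOn ((hbracket he (hmul hf he')).1 x)
      (add_mem (Submodule.smul_mem _ _ ((hbracket he he').1 x))
        (Submodule.smul_mem _ _ (he'.1 x))) ?_
    rw [map_add, map_smul, map_smul, hψ.map_bracket _ he _ (hmul hf he'),
      hψ.map_bracket _ he _ he', ← hderiv e he.1,
      ← hA'.anchored_derivation _ (hmem he) _ (hmem he') f hf]
    simp only [map_smul]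
  · rw [hpair e₁ e₂ h₁.1 h₂.1, ← hderiv e he.1,
      hA'.bracket_metric _ (hmem he) _ (hmem h₁) _ (hmem h₂),
      ← hψ.isometry x _ ((hbracket he h₁).1 x) _ (h₂.1 x),
      ← hψ.isometry x _ (h₁.1 x) _ ((hbracket he h₂).1 x), hψ.map_bracket _ he _ h₁,
      hψ.map_bracket _ he _ h₂]
  · rw [hpair e e he.1 he.1, ← hderiv e₁ h₁.1, ← hA'.bracket_self _ (hmem he) _ (hmem h₁),
      ← hψ.isometry x _ ((hbracket he he).1 x) _ (h₁.1 x), hψ.map_bracket _ he _ he]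

end Transport

/-! ### The fundamental form and the canonical D-bracket -/

section ParaKahler

variable {E : Type*} [NormedAddCommGroup E] [NormedSpace ℝ E]
  {H : Type*} [TopologicalSpace H] {I : ModelWithCorners ℝ E H}
  {M : Type*} [TopologicalSpace M] [ChartedSpace H M] [IsManifold I ∞ M]
  {η : PseudoRiemannianMetric I M} {K : ∀ x : M, TangentSpace I x →L[ℝ] TangentSpace I x} {d : ℕ}

lemma IsAlmostParaHermitian.apply_left (hK : IsAlmostParaHermitian η K d) (x : M)
    (v w : TangentSpace I x) : η x (K x v) w = -η x v (K x w) := by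
  simpa only [hK.sq] using hK.compatible x v (K x w)

lemma IsAlmostParaHermitian.smooth_apply (hK : IsAlmostParaHermitian η K d)
    {X : ∀ x : M, TangentSpace I x} (hX : Smooth I E X) : Smooth I E (fun x ↦ K x (X x)) :=
  fun x ↦ ContMDiffAt.clm_bundle_apply (F₁ := E) (F₂ := E)
    (E₁ := (TangentSpace I : M → Type _)) (E₂ := (TangentSpace I : M → Type _)) (b := fun y ↦ y)
    (ϕ := K) (v := X) (hK.smooth x) (hX x)

variable [FiniteDimensional ℝ E]

/-- `(∇_X ω)(Y, Z)` for the fundamental form `ω` and the Levi-Civita connection `∇`. -/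
noncomputable def covDerivFundamentalForm (η : PseudoRiemannianMetric I M)
    (K : ∀ x : M, TangentSpace I x →L[ℝ] TangentSpace I x) (X Y Z : ∀ x : M, TangentSpace I x)
    (x : M) : ℝ :=
  η x (leviCivita η (fun y ↦ K y (Y y)) x (X x)) (Z x) +
    η x (leviCivita η Y x (X x)) (K x (Z x))

local notation "∇ω" => covDerivFundamentalForm η K

/-- `dω` is the cyclic sum of `∇ω`, as the Levi-Civita connection is torsion-free. -/
lemma IsAlmostParaKahler.cyclic_sum (hK : IsAlmostParaKahler η K d)
    {X Y Z : ∀ x : M, TangentSpace I x} (hX : Smooth I E X) (hY : Smooth I E Y)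
    (hZ : Smooth I E Z) (x : M) : ∇ω X Y Z x + ∇ω Y Z X x + ∇ω Z X Y x = 0 := by
  have hd := hK.closed X Y Z hX hY hZ x
  have hm {A B C : ∀ x : M, TangentSpace I x} (hA : Smooth I E A) (hB : Smooth I E B) :
      d% (fun y ↦ fundamentalForm η K y (A y) (B y)) x (C x) = _ :=
    leviCivita_metric η (hK.smooth_apply hA x).mdifferentiableAt (hB x).mdifferentiableAt (C x)
  rw [hm hY hZ, hm hZ hX, hm hX hY] at hd
  simp only [fundamentalForm, hK.apply_left,
    ← leviCivita_sub η (hX x).mdifferentiableAt (hY x).mdifferentiableAt,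
    ← leviCivita_sub η (hY x).mdifferentiableAt (hZ x).mdifferentiableAt,
    ← leviCivita_sub η (hZ x).mdifferentiableAt (hX x).mdifferentiableAt, map_sub, sub_apply]
    at hd
  simp only [covDerivFundamentalForm]
  have hs (v w : TangentSpace I x) : η x v (K x w) = -η x w (K x v) := by
    rw [η.symm, hK.apply_left]
  linear_combination hd + hs (Y x) (leviCivita η Z x (X x)) + hs (Z x) (leviCivita η X x (Y x)) +
    hs (X x) (leviCivita η Y x (Z x))

/-- `∇_X ω` is skew-symmetric, as the derivative of the skew-symmetric `ω`. -/
lemma IsAlmostParaHermitian.covDeriv_swap (hK : IsAlmostParaHermitian η K d)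
    {X Y Z : ∀ x : M, TangentSpace I x} (hY : Smooth I E Y) (hZ : Smooth I E Z) (x : M) :
    ∇ω X Y Z x = -∇ω X Z Y x := by
  have h1 := leviCivita_metric η (hK.smooth_apply hY x).mdifferentiableAt
    (hZ x).mdifferentiableAt (X x)
  have h2 := leviCivita_metric η (hY x).mdifferentiableAt
    (hK.smooth_apply hZ x).mdifferentiableAt (X x)
  have h3 : (fun y ↦ η y (K y (Y y)) (Z y)) = -fun y ↦ η y (Y y) (K y (Z y)) :=
    funext fun y ↦ hK.apply_left y _ _
  rw [h3, mvfderiv_neg, neg_apply, h2] at h1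
  simp only [covDerivFundamentalForm]
  rw [η.symm x _ (Y x), η.symm x _ (K x (Y x))]
  linear_combination -h1

/-- `(∇_X ω)(KY, Z) = (∇_X ω)(Y, KZ)`, that is, `∇_X K` anticommutes with `K`. -/
lemma IsAlmostParaHermitian.covDeriv_apply_left (hK : IsAlmostParaHermitian η K d)
    (X Y Z : ∀ x : M, TangentSpace I x) (x : M) :
    ∇ω X (fun y ↦ K y (Y y)) Z x = ∇ω X Y (fun y ↦ K y (Z y)) x := by
  simp only [covDerivFundamentalForm, hK.sq]
  ring

/-- If `dω = 0`, then the cyclic sum of `(∇_X ω)(Y, KZ)` vanishes: in terms of the eigenbundles of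
`K`, the form `∇_X ω` has no component of mixed type, so the value of `dω` on arguments of which two
are of one type and one of the other is a single term `∇ω`, and each of these terms vanishes; on
three arguments of the same type the cyclic sum is `±dω`. -/
lemma IsAlmostParaKahler.cyclic_sum_apply (hK : IsAlmostParaKahler η K d)
    {X Y Z : ∀ x : M, TangentSpace I x} (hX : Smooth I E X) (hY : Smooth I E Y)
    (hZ : Smooth I E Z) (x : M) :
    ∇ω X Y (fun y ↦ K y (Z y)) x + ∇ω Y Z (fun y ↦ K y (X y)) x +
      ∇ω Z X (fun y ↦ K y (Y y)) x = 0 := by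
  have hX' := hK.smooth_apply hX
  have hY' := hK.smooth_apply hY
  have hZ' := hK.smooth_apply hZ
  -- In `dω(KX, Y, Z) + dω(X, KY, Z) + dω(X, Y, KZ)` every `(∇_X ω)(Y, KZ)` occurs twice, and the
  -- remaining terms `(∇_{KX} ω)(Y, Z)` sum to `dω(KX, KY, KZ)`.
  have h1 := hK.cyclic_sum hX' hY hZ x
  have h2 := hK.cyclic_sum hX hY' hZ x
  have h3 := hK.cyclic_sum hX hY hZ' x
  have h4 := hK.cyclic_sum hX' hY' hZ' x
  simp only [hK.covDeriv_apply_left, hK.sq] at h1 h2 h3 h4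
  linear_combination (h1 + h2 + h3 - h4) / 2

/-- The canonical connection is `∇ + ½ K ∘ ∇K`, here paired with a vector field `Z`. -/
lemma IsAlmostParaHermitian.apply_canonicalConnection (hK : IsAlmostParaHermitian η K d)
    (X : ∀ x : M, TangentSpace I x) {Y Z : ∀ x : M, TangentSpace I x} (hY : Smooth I E Y)
    (x : M) :
    η x (canonicalConnection η K Y x (X x)) (Z x) = η x (leviCivita η Y x (X x)) (Z x) -
      1 / 2 * ∇ω X Y (fun y ↦ K y (Z y)) x := by
  have hd := (hY x).mdifferentiableAt
  have hd' := (hK.smooth_apply hY x).mdifferentiableAt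
  have hp : leviCivita η (fun y ↦ projPlus K y (Y y)) x =
      (1 / 2 : ℝ) • (leviCivita η Y x + leviCivita η (fun y ↦ K y (Y y)) x) := by
    rw [← leviCivita_add η hd hd', ← leviCivita_const_smul η _
      (mdifferentiableAt_add_section hd hd')]
    rfl
  have hm : leviCivita η (fun y ↦ projMinus K y (Y y)) x =
      (1 / 2 : ℝ) • (leviCivita η Y x - leviCivita η (fun y ↦ K y (Y y)) x) := by
    have h1 := leviCivita_const_smul η (-1) hd'
    have hd'' : MDiffAt (T% ((-1 : ℝ) • fun y ↦ K y (Y y))) x :=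
      mdifferentiableAt_const.smul_section hd'
    rw [sub_eq_add_neg, ← neg_one_smul ℝ (leviCivita η (fun y ↦ K y (Y y)) x), ← h1,
      ← leviCivita_add η hd hd'',
      ← leviCivita_const_smul η _ (mdifferentiableAt_add_section hd hd'')]
    congr 1
    funext y
    simp [projMinus, sub_eq_add_neg]
  rw [canonicalConnection, hp, hm]
  simp only [projPlus, projMinus, covDerivFundamentalForm, hK.sq,
    add_apply, ContinuousLinearMap.comp_apply, smul_apply, sub_apply, map_add, map_sub, map_smul,
    ContinuousLinearMap.id_apply, hK.apply_left, smul_eq_mul]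
  ring

/-- On an almost para-Kähler manifold the canonical D-bracket is the D-bracket of the Levi-Civita
connection: the difference of the two, paired with `Z`, is `-½` times the cyclic sum of
`(∇_X ω)(Y, KZ)`. -/
lemma IsAlmostParaKahler.canonicalDBracket_eq [T2Space M] (hK : IsAlmostParaKahler η K d)
    {X Y : ∀ x : M, TangentSpace I x} (hX : Smooth I E X) (hY : Smooth I E Y) (x : M) :
    canonicalDBracket η K X Y x = leviCivitaDBracket η X Y x := by
  refine η.eq_of_apply fun w ↦ ?_
  obtain ⟨Z, hZ, rfl⟩ := exists_smooth_extension w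
  rw [apply_leviCivitaDBracket]
  simp only [canonicalDBracket, map_add, map_sub, add_apply, sub_apply, η.apply_flat_symm,
    ContinuousLinearMap.comp_apply]
  rw [η.symm x (Y x), η.symm x (Y x), hK.apply_canonicalConnection X hY,
    hK.apply_canonicalConnection Y hX, hK.apply_canonicalConnection Z hX,
    ← hK.covDeriv_apply_left Y X Z, hK.covDeriv_swap (hK.smooth_apply hX) hZ]
  linear_combination (-1 / 2 : ℝ) * hK.cyclic_sum_apply hX hY hZ x

lemma isMetricAlgebroid_canonicalAlgebroid [T2Space M] (hK : IsAlmostParaKahler η K d) :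
    IsMetricAlgebroid E (canonicalAlgebroid η K) := by
  have hiso : IsMetricAlgebroidIso E E (canonicalAlgebroid η K) (leviCivitaAlgebroid η)
      (fun _ ↦ LinearMap.id) :=
    ⟨fun x ↦ Set.bijOn_id _, fun _ _ _ ↦ Iff.rfl, fun _ _ _ ↦ rfl, fun _ _ _ _ _ ↦ rfl,
      fun _ h₁ _ h₂ x ↦ hK.canonicalDBracket_eq h₁.2 h₂.2 x⟩
  exact hiso.isMetricAlgebroid (isMetricAlgebroid_leviCivitaAlgebroid η)
    (exists_smooth_frame I M) fun _ _ _ _ _ ↦ trivial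

lemma IsAlmostParaHermitian.mapsTo_doubledEndo (hK : IsAlmostParaHermitian η K d) (x : M) :
    Set.MapsTo (doubledEndo K x) (Cplus η x) (Cplus η x) := by
  intro p hp
  rw [SetLike.mem_coe, mem_Cplus] at hp ⊢
  ext w
  simp [doubledEndo, hp, η.flat_apply, hK.apply_left]

lemma inducedParaComplex_eq : inducedParaComplex η K = K := by
  funext x
  ext v
  obtain ⟨p, rfl⟩ := (rhoPlus η x).surjective v
  simp only [inducedParaComplex, LinearMap.coe_toContinuousLinearMap', LinearMap.comp_apply,
    LinearEquiv.coe_coe, LinearEquiv.symm_apply_apply]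
  rfl

end ParaKahler

/-! ### The algebroid on `C₊` -/

section Cplus

variable {E : Type*} [NormedAddCommGroup E] [NormedSpace ℝ E] [FiniteDimensional ℝ E]
  {H : Type*} [TopologicalSpace H] {I : ModelWithCorners ℝ E H}
  {M : Type*} [TopologicalSpace M] [ChartedSpace H M] [IsManifold I ∞ M]
  (η : PseudoRiemannianMetric I M)

lemma pPlus_mem_Cplus {x : M} (p : GenTangent I x) : pPlus η x p ∈ Cplus η x := by
  rw [mem_Cplus]
  simp [pPlus, swapInvolution, add_comm]

lemma isSmoothSubbundle_Cplus : IsSmoothSubbundle I (E × (E →L[ℝ] ℝ)) (Cplus η) := by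
  intro x₀
  obtain ⟨U, hU, hx₀, n, b, hb⟩ := exists_smooth_frame I M x₀
  refine ⟨U, hU, hx₀, n, fun i x ↦ (b i x, η x (b i x)), fun x hx ↦ ?_⟩
  obtain ⟨hs, hli, hsp⟩ := hb x hx
  refine ⟨fun i ↦ smoothAt_prod_iff.2 ⟨hs i, η.smoothAt_flat (hs i)⟩,
    LinearIndependent.of_comp (LinearMap.fst ℝ (TangentSpace I x) (Cotangent I x)) hli, ?_⟩
  have hr : (Set.range fun i ↦ ((b i x, η x (b i x)) : GenTangent I x)) =
      (LinearMap.prod LinearMap.id (η.flat x).toLinearMap) '' Set.range fun i ↦ b i x := by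
    rw [← Set.range_comp]
    rfl
  rw [hr, Submodule.span_image, hsp]
  ext p
  rw [mem_Cplus]
  constructor
  · rintro ⟨v, -, rfl⟩
    rfl
  · exact fun h ↦ ⟨p.1, trivial, Prod.ext rfl h.symm⟩

/-- The projection of the Dorfman bracket of `X + η(X, ·)` and `Y + η(Y, ·)` to `C₊` has
vector part the D-bracket of the Levi-Civita connection. -/
lemma pPlus_dorfman_fst {X Y : ∀ x : M, TangentSpace I x} {x : M} (hX : SmoothAt I E X x)
    (hY : SmoothAt I E Y x) :
    (pPlus η x (dorfman (fun y ↦ (X y, η y (X y))) (fun y ↦ (Y y, η y (Y y))) x)).1 =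
      leviCivitaDBracket η X Y x := by
  refine η.eq_of_apply fun w ↦ ?_
  obtain ⟨Z, hZ, rfl⟩ : ∃ Z : ∀ x : M, TangentSpace I x, MDiffAt (T% Z) x ∧ Z x = w :=
    ⟨FiberBundle.extend E w, mdifferentiableAt_extend .., by simp⟩
  have hX₁ := hX.mdifferentiableAt
  have hY₁ := hY.mdifferentiableAt
  have hform {A : ∀ x : M, TangentSpace I x} (hA : SmoothAt I E A x) :
      FormDiffAt (fun y ↦ η y (A y)) x :=
    ContMDiffAt.mdifferentiableAt (n := ∞) (η.smoothAt_flat hA) (by simp)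
  have hL : lieOneForm X (fun y ↦ η y (Y y)) x (Z x) =
      lieOneFormAux X (fun y ↦ η y (Y y)) x Z := by
    rw [lieOneForm, dif_pos (hform hY)]
    exact TensorialAt.mkHom_apply _ hZ
  have hd : dOneForm (fun y ↦ η y (X y)) x (Y x) (Z x) =
      dOneFormAux (fun y ↦ η y (X y)) x Y Z := by
    rw [dOneForm, dif_pos (hform hX)]
    exact TensorialAt.mkHom₂_apply _ _ hY₁ hZ
  have hp : η x (pPlus η x (dorfman (fun y ↦ (X y, η y (X y))) (fun y ↦ (Y y, η y (Y y))) x)).1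
      (Z x) = 1 / 2 * (η x (mlieBracket I X Y x) (Z x) +
        (lieOneFormAux X (fun y ↦ η y (Y y)) x Z - dOneFormAux (fun y ↦ η y (X y)) x Y Z)) := by
    rw [← hL, ← hd]
    simp [pPlus, swapInvolution, dorfman, η.apply_flat_symm]
    ring
  rw [hp, apply_leviCivitaDBracket]
  simp only [lieOneFormAux, dOneFormAux, leviCivita_metric η hY₁ hZ, leviCivita_metric η hX₁ hZ,
    leviCivita_metric η hX₁ hY₁, ← leviCivita_sub η hX₁ hY₁, ← leviCivita_sub η hX₁ hZ,
    ← leviCivita_sub η hY₁ hZ, map_sub, sub_apply]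
  rw [η.symm x (Y x) (leviCivita η X x (Z x))]
  ring

/-- The anchor identifies `C₊` with the tangent bundle equipped with the D-bracket of the
Levi-Civita connection; no para-complex structure is involved. -/
lemma isMetricAlgebroidIso_anchor :
    IsMetricAlgebroidIso (E × (E →L[ℝ] ℝ)) E (plusAlgebroid η) (leviCivitaAlgebroid η)
      (plusAlgebroid η).anchor := by
  have hsec (e : ∀ x : M, GenTangent I x) (he : ∀ x, e x ∈ Cplus η x) :
      e = fun y ↦ ((e y).1, η y (e y).1) :=
    funext fun y ↦ Prod.ext rfl ((mem_Cplus η).1 (he y))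
  have hsm (e : ∀ x : M, GenTangent I x) (he : ∀ x, e x ∈ Cplus η x) (x : M) :
      SmoothAt I E (fun y ↦ (e y).1) x ↔ SmoothAt I (E × (E →L[ℝ] ℝ)) e x := by
    conv_rhs => rw [hsec e he, smoothAt_prod_iff]
    exact ⟨fun h ↦ ⟨h, η.smoothAt_flat h⟩, fun h ↦ h.1⟩
  refine ⟨fun x ↦ ⟨fun _ _ ↦ trivial, ?_, ?_⟩, hsm, fun _ _ _ ↦ rfl, ?_, ?_⟩
  · intro p hp q hq h
    have h' : p.1 = q.1 := h
    rw [SetLike.mem_coe, plusAlgebroid, mem_Cplus] at hp hq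
    exact Prod.ext h' (by rw [hp, hq, h'])
  · exact fun v _ ↦ ⟨(v, η.flat x v), (mem_Cplus η).2 rfl, rfl⟩
  · intro x v hv w hw
    change η x v.1 w.1 = (1 / 2 : ℝ) * (w.2 v.1 + v.2 w.1)
    rw [(mem_Cplus η).1 hv, (mem_Cplus η).1 hw, η.flat_apply, η.flat_apply, η.symm x w.1 v.1]
    ring
  · intro e₁ h₁ e₂ h₂ x
    have h := pPlus_dorfman_fst η ((hsm e₁ h₁.1 x).2 (h₁.2 x)) ((hsm e₂ h₂.1 x).2 (h₂.2 x))
    rw [← hsec e₁ h₁.1, ← hsec e₂ h₂.1] at h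
    exact h

lemma isMetricAlgebroid_plusAlgebroid [T2Space M] :
    IsMetricAlgebroid (E × (E →L[ℝ] ℝ)) (plusAlgebroid η) :=
  (isMetricAlgebroidIso_anchor η).isMetricAlgebroid (isMetricAlgebroid_leviCivitaAlgebroid η)
    (isSmoothSubbundle_Cplus η) fun _ _ _ _ _ ↦ pPlus_mem_Cplus η _

end Cplus

end DoubledGeometry

theorem proposition5p3 {d : ℕ} {M : Type*} [TopologicalSpace M] [T2Space M]
    [SecondCountableTopology M] [ChartedSpace (EuclideanSpace ℝ (Fin (2 * d))) M]
    [IsManifold (𝓡 (2 * d)) ∞ M]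
    (η : DoubledGeometry.PseudoRiemannianMetric (𝓡 (2 * d)) M)
    (K : ∀ x : M, TangentSpace (𝓡 (2 * d)) x →L[ℝ] TangentSpace (𝓡 (2 * d)) x)
    (hK : DoubledGeometry.IsAlmostParaKahler η K d) :
    (∀ x, Set.MapsTo (DoubledGeometry.doubledEndo K x)
      (DoubledGeometry.Cplus η x) (DoubledGeometry.Cplus η x)) ∧
    DoubledGeometry.IsAlmostParaHermitian η (DoubledGeometry.inducedParaComplex η K) d ∧
    DoubledGeometry.IsMetricAlgebroid
      (EuclideanSpace ℝ (Fin (2 * d)) × (EuclideanSpace ℝ (Fin (2 * d)) →L[ℝ] ℝ))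
      (DoubledGeometry.plusAlgebroid η) ∧
    DoubledGeometry.IsMetricAlgebroid (EuclideanSpace ℝ (Fin (2 * d)))
      (DoubledGeometry.canonicalAlgebroid η (DoubledGeometry.inducedParaComplex η K)) ∧
    DoubledGeometry.IsMetricAlgebroidIso
      (EuclideanSpace ℝ (Fin (2 * d)) × (EuclideanSpace ℝ (Fin (2 * d)) →L[ℝ] ℝ))
      (EuclideanSpace ℝ (Fin (2 * d)))
      (DoubledGeometry.plusAlgebroid η)
      (DoubledGeometry.canonicalAlgebroid η (DoubledGeometry.inducedParaComplex η K))
      (DoubledGeometry.plusAlgebroid η).anchor := by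
  rw [DoubledGeometry.inducedParaComplex_eq]
  have hiso := DoubledGeometry.isMetricAlgebroidIso_anchor η
  refine ⟨hK.mapsTo_doubledEndo, hK.toIsAlmostParaHermitian,
    DoubledGeometry.isMetricAlgebroid_plusAlgebroid η,
    DoubledGeometry.isMetricAlgebroid_canonicalAlgebroid hK,
    hiso.bijOn, hiso.smooth_iff, hiso.anchor_comp, hiso.isometry, fun e₁ h₁ e₂ h₂ x ↦ ?_⟩
  rw [hiso.map_bracket e₁ h₁ e₂ h₂ x]
  exact (hK.canonicalDBracket_eq (fun y ↦ (hiso.smooth_iff e₁ h₁.1 y).2 (h₁.2 y))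
    (fun y ↦ (hiso.smooth_iff e₂ h₂.1 y).2 (h₂.2 y)) x).symm
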